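/- Let $A$ be a simple unital C*-algebra that is not one-dimensional (i.e. $A\not\cong\mathbb C$), let $G$ be a countable discrete amenable group, let $\alpha\colon G\to\mathrm{Aut}(A)$ be an action, and let $\omega$ be a free ultrafilter on $\mathbb N$. Let $A^\omega=\ell^\infty(\mathbb N,A)/\{(a_n):\lim_{n\to\omega}\|a_n\|=0\}$, let $A_\omega=A^\omega\cap A'$ be the central sequence algebra, and write $\alpha$ also for the induced action on $A^\omega$. For positive $a,b\in A$ write $a\precsim b$ (Cuntz subequivalence) if $r_nbr_n^*\to a$ for some sequence $(r_n)$ in $A$. For a finite set $K\subset G$ and $\varepsilon>0$, a nonempty finite set $T\subset G$ is called $(K,\varepsilon)$-invariant if $|T\cap\bigcap_{g\in K}gT|\ge(1-\varepsilon)|T|$. Suppose that $\alpha$ has the weak tracial Rokhlin property: for every finite $K\subset G$, every $\varepsilon>0$ and every nonzero positive $z\in A$ there are $(K,\varepsilon)$-invariant finite sets $T_1,\dots,T_n\subset G$ and positive contractions $e_1,\dots,e_n\in A_\omega$ such that (1) $\alpha_g(e_i)\alpha_h(e_j)=0$ whenever $g\in T_i$, $h\in T_j$ and $g\ne h$ or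 $i\ne j$; (2) $1-\sum_{i=1}^n\sum_{g\in T_i}\alpha_g(e_i)\in A^\omega$ has a representative $(f_m)_{m\in\mathbb N}$ such that every $f_m\in A$ is positive and satisfies $f_m\precsim z$. Let $A\rtimes_\alpha G$ be the full crossed product, that is, the universal C*-algebra generated by $A$ and unitaries $(\lambda_g)_{g\in G}$ with $\lambda_g\lambda_h=\lambda_{gh}$ and $\lambda_ga\lambda_g^*=\alpha_g(a)$. Then restriction along the canonical embedding $A\to A\rtimes_\alpha G$ is a bijection from the set $\mathrm T(A\rtimes_\alpha G)$ of tracial states of $A\rtimes_\alpha G$ onto the set $\mathrm T^\alpha(A)$ of $\alpha$-invariant tracial states of $A$. Moreover, every $\Phi\in \mathrm T(A\rtimes_\alpha G)$ satisfies $\Phi(a\lambda_g)=0$ for all $a\in A$ and all $g\in G\setminus\{1\}$. -/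

import Mathlib

open scoped ENNReal Pointwise ComplexOrder BoundedContinuousFunction

noncomputable section

namespace TracialRokhlin

universe u v w

/-! ### Amenability, simplicity, positivity, Cuntz comparison, traces -/

/-- A nonempty finite set `T` is `(K, ε)`-invariant if `|T ∩ ⋂_{g ∈ K} gT| ≥ (1 - ε)|T|`. -/
def IsInvariantSet {G : Type v} [Group G] (K : Finset G) (ε : ℝ) (T : Finset G) : Prop :=
  T.Nonempty ∧
    (1 - ε) * (T.card : ℝ) ≤ (((T : Set G) ∩ ⋂ g ∈ K, g • (T : Set G)).ncard : ℝ)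

/-- Amenability of a discrete group. -/
def IsAmenableGroup (G : Type v) [Group G] : Prop :=
  ∀ (K : Finset G) (ε : ℝ), 0 < ε → ∃ T : Finset G, IsInvariantSet K ε T

/-- A C⋆-algebra is simple if it is nonzero and its only closed two-sided ideals are trivial. -/
def IsSimpleCStarAlgebra (A : Type u) [CStarAlgebra A] : Prop :=
  Nontrivial A ∧ ∀ I : TwoSidedIdeal A, IsClosed (I : Set A) → I = ⊥ ∨ I = ⊤

/-- Positive elements of a C⋆-algebra: self-adjoint with nonnegative spectrum. -/
def IsPositiveElement {B : Type u} [CStarAlgebra B] (b : B) : Prop :=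
  letI := CStarAlgebra.spectralOrder B
  0 ≤ b

/-- Cuntz subequivalence `a ≾ b`: there are `r n` with `r n * b * (r n)⋆ → a`. -/
def CuntzSubequiv {B : Type u} [CStarAlgebra B] (a b : B) : Prop :=
  ∃ r : ℕ → B, Filter.Tendsto (fun n => r n * b * star (r n)) Filter.atTop (nhds a)

/-- The set `T(B)` of tracial states: positive linear functionals `τ` with `τ 1 = 1` and
`τ (x * y) = τ (y * x)`. -/
def tracialStates (B : Type u) [CStarAlgebra B] : Set (B →ₗ[ℂ] ℂ) :=
  {τ | τ 1 = 1 ∧ (∀ x, 0 ≤ τ (star x * x)) ∧ ∀ x y, τ (x * y) = τ (y * x)}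

/-- The set `T^α(A)` of `α`-invariant tracial states. -/
def invariantTracialStates {A : Type u} [CStarAlgebra A] {G : Type v} [Group G]
    (α : G →* (A ≃⋆ₐ[ℂ] A)) : Set (A →ₗ[ℂ] ℂ) :=
  {τ | τ ∈ tracialStates A ∧ ∀ g a, τ (α g a) = τ a}

/-! ### The ultrapower `A^ω = ℓ^∞(ℕ, A) / c_ω(A)` -/

section Ultrapower

variable (ω : Ultrafilter ℕ) (A : Type u) [CStarAlgebra A]

/-- The ideal `c_ω(A)` of bounded sequences with `lim_{n → ω} ‖a n‖ = 0`; here `ℓ^∞(ℕ, A)` is the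
C⋆-algebra `ℕ →ᵇ A` of bounded functions on the discrete space `ℕ`. -/
def cOmega : Ideal (ℕ →ᵇ A) where
  carrier := {x | Filter.Tendsto (fun n => ‖x n‖) ω (nhds 0)}
  zero_mem' := by simp
  add_mem' := by
    intro x y hx hy
    have h := Filter.Tendsto.add hx hy
    rw [add_zero] at h
    exact squeeze_zero (fun n => norm_nonneg _) (fun n => norm_add_le _ _) h
  smul_mem' := by
    intro c x hx
    have h := Filter.Tendsto.const_mul ‖c‖ hx
    rw [mul_zero] at h
    refine squeeze_zero (fun n => norm_nonneg _) (fun n => ?_) h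
    exact (norm_mul_le _ _).trans
      (mul_le_mul_of_nonneg_right (c.norm_coe_le_norm n) (norm_nonneg _))

variable {ω A}

theorem mem_cOmega {x : ℕ →ᵇ A} :
    x ∈ cOmega ω A ↔ Filter.Tendsto (fun n => ‖x n‖) ω (nhds 0) := Iff.rfl

instance : (cOmega ω A).IsTwoSided := ⟨by
  intro x c hx
  have h := Filter.Tendsto.mul_const ‖c‖ (mem_cOmega.1 hx)
  rw [zero_mul] at h
  refine squeeze_zero (fun n => norm_nonneg _) (fun n => ?_) h
  exact (norm_mul_le _ _).trans
    (mul_le_mul_of_nonneg_left (c.norm_coe_le_norm n) (norm_nonneg _))⟩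

theorem star_mem_cOmega {x : ℕ →ᵇ A} (hx : x ∈ cOmega ω A) : star x ∈ cOmega ω A := by
  rw [mem_cOmega] at hx ⊢
  simpa using hx

variable (ω A) in
/-- The ultrapower `A^ω`. -/
def Ultrapower : Type u := (ℕ →ᵇ A) ⧸ cOmega ω A

namespace Ultrapower

instance : Ring (Ultrapower ω A) := inferInstanceAs (Ring ((ℕ →ᵇ A) ⧸ cOmega ω A))

instance : Algebra ℂ (Ultrapower ω A) := inferInstanceAs (Algebra ℂ ((ℕ →ᵇ A) ⧸ cOmega ω A))

variable (ω A) in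
/-- The quotient map `ℓ^∞(ℕ, A) → A^ω`. -/
def mk : (ℕ →ᵇ A) →ₐ[ℂ] Ultrapower ω A := Ideal.Quotient.mkₐ ℂ (cOmega ω A)

theorem mk_surjective : Function.Surjective (mk ω A) := Ideal.Quotient.mk_surjective

theorem mk_eq_mk {x y : ℕ →ᵇ A} : mk ω A x = mk ω A y ↔ x - y ∈ cOmega ω A :=
  Ideal.Quotient.mk_eq_mk_iff_sub_mem x y

/-- The quotient norm. -/
instance : SeminormedAddCommGroup (Ultrapower ω A) :=
  inferInstanceAs (SeminormedAddCommGroup ((ℕ →ᵇ A) ⧸ cOmega ω A))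

instance : CompleteSpace (Ultrapower ω A) :=
  inferInstanceAs (CompleteSpace ((ℕ →ᵇ A) ⧸ cOmega ω A))

theorem exists_norm_lt (x : Ultrapower ω A) {ε : ℝ} (hε : 0 < ε) :
    ∃ m, mk ω A m = x ∧ ‖m‖ < ‖x‖ + ε :=
  Submodule.Quotient.norm_mk_lt (S := cOmega ω A) x hε

theorem norm_mk_le (x : ℕ →ᵇ A) : ‖mk ω A x‖ ≤ ‖x‖ :=
  Submodule.Quotient.norm_mk_le (cOmega ω A) x

/-- The quotient norm of a bounded sequence is its norm limit along `ω`. -/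
theorem norm_mk_le_iff (x : ℕ →ᵇ A) {r : ℝ} (hr : 0 ≤ r) :
    ‖mk ω A x‖ ≤ r ↔ ∀ ε > 0, ∀ᶠ n in (ω : Filter ℕ), ‖x n‖ ≤ r + ε := by
  constructor
  · intro h ε hε
    obtain ⟨m, hm, hlt⟩ := exists_norm_lt (mk ω A x) (half_pos hε)
    have h0 : Filter.Tendsto (fun n => ‖(m - x) n‖) ω (nhds 0) := mk_eq_mk.1 hm
    filter_upwards [h0.eventually (gt_mem_nhds (half_pos hε))] with n hn
    have h1 : ‖x n‖ ≤ ‖m n‖ + ‖(m - x) n‖ := by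
      have : x n = m n - (m - x) n := by simp
      rw [this]; exact norm_sub_le _ _
    have h2 := m.norm_coe_le_norm n
    linarith
  · intro h
    refine le_of_forall_pos_le_add fun ε hε => ?_
    classical
    let c : ℕ →ᵇ A := BoundedContinuousFunction.ofNormedAddCommGroup
      (fun n => if ‖x n‖ ≤ r + ε then x n else 0) continuous_of_discreteTopology (r + ε) (by
        intro n
        split_ifs with hn
        · exact hn
        · rw [norm_zero]; linarith)
    have hc : mk ω A x = mk ω A c := by
      rw [mk_eq_mk, mem_cOmega]
      refine tendsto_const_nhds.congr' ?_
      filter_upwards [h ε hε] with n hn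
      have : c n = x n := if_pos hn
      simp [this]
    rw [hc]
    refine (norm_mk_le c).trans ?_
    exact BoundedContinuousFunction.norm_ofNormedAddCommGroup_le _ (by linarith) _

instance : NormedRing (Ultrapower ω A) :=
  { (inferInstance : SeminormedAddCommGroup (Ultrapower ω A)),
    (inferInstance : Ring (Ultrapower ω A)) with
    eq_of_dist_eq_zero := by
      intro x y hxy
      obtain ⟨x, rfl⟩ := mk_surjective x
      obtain ⟨y, rfl⟩ := mk_surjective y
      have hxy' : ‖mk ω A (x - y)‖ = 0 := by
        rw [map_sub, ← dist_eq_norm]; exact hxy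
      rw [mk_eq_mk, mem_cOmega]
      have h := (norm_mk_le_iff (ω := ω) (x - y) le_rfl).1 hxy'.le
      rw [Metric.tendsto_nhds]
      intro ε hε
      filter_upwards [h (ε / 2) (half_pos hε)] with n hn
      rw [Real.dist_eq, sub_zero, abs_of_nonneg (norm_nonneg _)]
      linarith
    norm_mul_le := by
      intro x y
      refine le_of_forall_pos_le_add fun ε hε => ?_
      have hcont : Filter.Tendsto (fun δ : ℝ => (‖x‖ + δ) * (‖y‖ + δ)) (nhdsWithin 0 (Set.Ioi 0))
          (nhds ((‖x‖ + 0) * (‖y‖ + 0))) :=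
        (Continuous.tendsto (by fun_prop) 0).mono_left nhdsWithin_le_nhds
      rw [add_zero, add_zero] at hcont
      obtain ⟨δ, hδ, hδ0⟩ := ((hcont.eventually (gt_mem_nhds
        (lt_add_of_pos_right (‖x‖ * ‖y‖) hε))).and self_mem_nhdsWithin).exists
      obtain ⟨a, rfl, ha⟩ := exists_norm_lt x hδ0
      obtain ⟨b, rfl, hb⟩ := exists_norm_lt y hδ0
      rw [← map_mul]
      calc ‖mk ω A (a * b)‖ ≤ ‖a * b‖ := norm_mk_le _
        _ ≤ ‖a‖ * ‖b‖ := norm_mul_le _ _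
        _ ≤ (‖mk ω A a‖ + δ) * (‖mk ω A b‖ + δ) :=
          mul_le_mul ha.le hb.le (norm_nonneg _) ((norm_nonneg _).trans ha.le)
        _ ≤ _ := hδ.le }

instance : NormedAlgebra ℂ (Ultrapower ω A) where
  norm_smul_le c x := by
    refine le_of_forall_pos_le_add fun ε hε => ?_
    obtain ⟨a, rfl, ha⟩ := exists_norm_lt x (ε := ε / (‖c‖ + 1)) (by positivity)
    rw [← map_smul]
    have h1 : ‖c‖ * (ε / (‖c‖ + 1)) ≤ ε := by
      rw [mul_div_assoc', div_le_iff₀ (by positivity)]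
      nlinarith [norm_nonneg c]
    calc ‖mk ω A (c • a)‖ ≤ ‖c • a‖ := norm_mk_le _
      _ ≤ ‖c‖ * ‖a‖ := norm_smul_le _ _
      _ ≤ ‖c‖ * (‖mk ω A a‖ + ε / (‖c‖ + 1)) := by gcongr
      _ ≤ _ := by rw [mul_add]; linarith

instance : Star (Ultrapower ω A) where
  star := Quotient.map' star (by
    intro x y hxy
    rw [Submodule.quotientRel_def] at hxy ⊢
    have := star_mem_cOmega hxy
    rwa [star_sub] at this)

theorem star_mk (x : ℕ →ᵇ A) : star (mk ω A x) = mk ω A (star x) := rfl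

instance : StarRing (Ultrapower ω A) where
  star_involutive x := by
    obtain ⟨x, rfl⟩ := mk_surjective x
    rw [star_mk, star_mk, star_star]
  star_mul x y := by
    obtain ⟨x, rfl⟩ := mk_surjective x
    obtain ⟨y, rfl⟩ := mk_surjective y
    rw [← map_mul, star_mk, star_mk, star_mk, star_mul, map_mul]
  star_add x y := by
    obtain ⟨x, rfl⟩ := mk_surjective x
    obtain ⟨y, rfl⟩ := mk_surjective y
    rw [← map_add, star_mk, star_mk, star_mk, star_add, map_add]

instance : StarModule ℂ (Ultrapower ω A) where
  star_smul c x := by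
    obtain ⟨x, rfl⟩ := mk_surjective x
    rw [← map_smul, star_mk, star_mk, star_smul, map_smul]

instance : CStarRing (Ultrapower ω A) where
  norm_mul_self_le x := by
    obtain ⟨x, rfl⟩ := mk_surjective x
    rw [star_mk, ← map_mul]
    set r := ‖mk ω A (star x * x)‖ with hr
    have hr0 : 0 ≤ r := norm_nonneg _
    have hx : ‖mk ω A x‖ ≤ √r := by
      rw [norm_mk_le_iff _ (Real.sqrt_nonneg r)]
      intro ε hε
      have h := (norm_mk_le_iff (star x * x) hr0).1 hr.ge (ε ^ 2) (by positivity)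
      filter_upwards [h] with n hn
      have h1 : ‖(star x * x) n‖ = ‖x n‖ * ‖x n‖ := CStarRing.norm_star_mul_self
      rw [h1] at hn
      refine abs_le_of_sq_le_sq' ?_ (by positivity) |>.2
      nlinarith [Real.sq_sqrt hr0, Real.sqrt_nonneg r]
    calc ‖mk ω A x‖ * ‖mk ω A x‖ ≤ √r * √r :=
          mul_self_le_mul_self (norm_nonneg _) hx
      _ = r := Real.mul_self_sqrt hr0

instance : CStarAlgebra (Ultrapower ω A) where

end Ultrapower

variable (ω A) in
/-- The embedding of `A` in `A^ω` as constant sequences. -/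
def constEmbedding (a : A) : Ultrapower ω A :=
  Ultrapower.mk ω A (BoundedContinuousFunction.const ℕ a)

variable (ω A) in
/-- The central sequence algebra `A_ω = A^ω ∩ A'`. -/
def centralSequenceAlgebra : Set (Ultrapower ω A) :=
  Set.centralizer (Set.range (constEmbedding ω A))

/-- The entrywise action of an automorphism on bounded sequences. -/
def seqMap (φ : A ≃⋆ₐ[ℂ] A) (x : ℕ →ᵇ A) : ℕ →ᵇ A :=
  BoundedContinuousFunction.ofNormedAddCommGroup (fun n => φ (x n))
    continuous_of_discreteTopology ‖x‖ (fun n => by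
      rw [NonUnitalStarAlgHom.norm_map φ φ.injective]
      exact x.norm_coe_le_norm n)

/-- The natural extension of an automorphism of `A` to `A^ω`: `[(x n)] ↦ [(φ (x n))]`. -/
def ultrapowerMap (φ : A ≃⋆ₐ[ℂ] A) : Ultrapower ω A → Ultrapower ω A :=
  Quotient.map' (seqMap φ) (by
    intro x y hxy
    rw [Submodule.quotientRel_def] at hxy ⊢
    rw [mem_cOmega] at hxy ⊢
    refine hxy.congr fun n => ?_
    have h : (seqMap φ x - seqMap φ y) n = φ ((x - y) n) := (map_sub φ (x n) (y n)).symm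
    rw [h, NonUnitalStarAlgHom.norm_map φ φ.injective])

theorem ultrapowerMap_mk (φ : A ≃⋆ₐ[ℂ] A) (x : ℕ →ᵇ A) :
    ultrapowerMap φ (Ultrapower.mk ω A x) = Ultrapower.mk ω A (seqMap φ x) := rfl

/-- `f ≾_{p.w.} a`: `f` has a representative `(f n)` with each `f n` positive and `f n ≾ a`. -/
def PointwiseCuntzSubequiv (f : Ultrapower ω A) (a : A) : Prop :=
  ∃ x : ℕ →ᵇ A, Ultrapower.mk ω A x = f ∧
    ∀ n, IsPositiveElement (x n) ∧ CuntzSubequiv (x n) a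

/-- The weak tracial Rokhlin property of an action `α` of `G` on `A`. -/
def HasWeakTracialRokhlinProperty (ω : Ultrafilter ℕ) {G : Type v} [Group G]
    (α : G →* (A ≃⋆ₐ[ℂ] A)) : Prop :=
  ∀ (K : Finset G) (ε : ℝ), 0 < ε → ∀ z : A, IsPositiveElement z → z ≠ 0 →
    ∃ (n : ℕ) (T : Fin n → Finset G) (e : Fin n → Ultrapower ω A),
      (∀ i, IsInvariantSet K ε (T i)) ∧
      (∀ i, e i ∈ centralSequenceAlgebra ω A ∧ IsPositiveElement (e i) ∧ ‖e i‖ ≤ 1) ∧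
      (∀ i j, ∀ g ∈ T i, ∀ h ∈ T j, (g ≠ h ∨ i ≠ j) →
        ultrapowerMap (α g) (e i) * ultrapowerMap (α h) (e j) = 0) ∧
      PointwiseCuntzSubequiv (1 - ∑ i, ∑ g ∈ T i, ultrapowerMap (α g) (e i)) z

end Ultrapower

/-! ### The full crossed product -/

section CrossedProduct

variable {A : Type u} [CStarAlgebra A] {G : Type v} [Group G]

/-- A covariant representation of `(A, G, α)` in a nonzero unital C⋆-algebra `carrier`: a unital
⋆-homomorphism `π` of `A` and a unitary representation `U` of `G` with
`U g * π a * (U g)⋆ = π (α g a)`. -/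
structure CovariantRep (α : G →* (A ≃⋆ₐ[ℂ] A)) where
  carrier : Type (max u v)
  [cstar : CStarAlgebra carrier]
  [nontriv : Nontrivial carrier]
  π : A →⋆ₐ[ℂ] carrier
  U : G →* unitary carrier
  covariant : ∀ g a, (U g : carrier) * π a * star (U g : carrier) = π (α g a)

attribute [instance] CovariantRep.cstar CovariantRep.nontriv

variable (α : G →* (A ≃⋆ₐ[ℂ] A))

/-- The `ℓ^∞`-product of the targets of all covariant representations. Every C⋆-algebra generated
by a copy of `A` and unitaries indexed by `G` embeds in one whose underlying type lies in
`Type (max u v)`, so that this family of representations is exhaustive. -/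
abbrev UniversalTarget : Type (max u v + 1) := lp (fun R : CovariantRep α => R.carrier) ∞

instance : CStarAlgebra (UniversalTarget α) where

/-- `a ↦ (π a)_{(π, U)}`. -/
def universalEmbed (a : A) : UniversalTarget α :=
  ⟨fun R => R.π a, memℓp_infty ⟨‖a‖, by
    rintro _ ⟨R, rfl⟩
    exact NonUnitalStarAlgHom.norm_apply_le R.π a⟩⟩

/-- `g ↦ (U g)_{(π, U)}`. -/
def universalUnitary (g : G) : UniversalTarget α :=
  ⟨fun R => (R.U g : R.carrier), memℓp_infty ⟨1, by
    rintro _ ⟨R, rfl⟩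
    exact (CStarRing.norm_of_mem_unitary (R.U g).2).le⟩⟩

/-- The closed ⋆-subalgebra generated by the images of `A` and `G`. -/
def crossedProductSubalgebra : StarSubalgebra ℂ (UniversalTarget α) :=
  (StarAlgebra.adjoin ℂ
    (Set.range (universalEmbed α) ∪ Set.range (universalUnitary α))).topologicalClosure

instance : IsClosed (crossedProductSubalgebra α : Set (UniversalTarget α)) :=
  StarSubalgebra.isClosed_topologicalClosure _

/-- The full crossed product `A ⋊_α G`: the universal C⋆-algebra generated by `A` and unitaries
`λ g` with `λ g * λ h = λ (g * h)` and `λ g * a * (λ g)⋆ = α g a`. -/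
def CrossedProduct : Type (max u v + 1) := crossedProductSubalgebra α

namespace CrossedProduct

instance : CStarAlgebra (CrossedProduct α) :=
  inferInstanceAs (CStarAlgebra (crossedProductSubalgebra α))

theorem universalEmbed_mem (a : A) : universalEmbed α a ∈ crossedProductSubalgebra α :=
  StarSubalgebra.le_topologicalClosure _
    (StarAlgebra.subset_adjoin ℂ _ (Or.inl ⟨a, rfl⟩))

theorem universalUnitary_mem (g : G) : universalUnitary α g ∈ crossedProductSubalgebra α :=
  StarSubalgebra.le_topologicalClosure _
    (StarAlgebra.subset_adjoin ℂ _ (Or.inr ⟨g, rfl⟩))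

/-- The canonical embedding `A → A ⋊_α G`. -/
def ofAlgebra : A →⋆ₐ[ℂ] CrossedProduct α where
  toFun a := ⟨universalEmbed α a, universalEmbed_mem α a⟩
  map_one' := Subtype.ext <| Subtype.ext <| funext fun R => map_one R.π
  map_mul' a b := Subtype.ext <| Subtype.ext <| funext fun R => map_mul R.π a b
  map_zero' := Subtype.ext <| Subtype.ext <| funext fun R => map_zero R.π
  map_add' a b := Subtype.ext <| Subtype.ext <| funext fun R => map_add R.π a b
  commutes' c := Subtype.ext <| Subtype.ext <| funext fun R => by
    exact R.π.toAlgHom.commutes c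
  map_star' a := Subtype.ext <| Subtype.ext <| funext fun R => map_star R.π a

/-- The canonical unitaries `λ g`. -/
def ofGroup : G →* unitary (CrossedProduct α) where
  toFun g := ⟨⟨universalUnitary α g, universalUnitary_mem α g⟩, by
    refine Unitary.mem_iff.2 ⟨Subtype.ext <| Subtype.ext <| funext fun R => (Unitary.mem_iff.1 (R.U g).2).1,
        Subtype.ext <| Subtype.ext <| funext fun R => (Unitary.mem_iff.1 (R.U g).2).2⟩⟩
  map_one' := Subtype.ext <| Subtype.ext <| Subtype.ext <| funext fun R =>
    congrArg Subtype.val (map_one R.U)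
  map_mul' g h := Subtype.ext <| Subtype.ext <| Subtype.ext <| funext fun R =>
    congrArg Subtype.val (map_mul R.U g h)

/-- The covariance relation in the crossed product. -/
theorem covariant (g : G) (a : A) :
    (ofGroup α g : CrossedProduct α) * ofAlgebra α a * star (ofGroup α g : CrossedProduct α) =
      ofAlgebra α (α g a) :=
  Subtype.ext <| Subtype.ext <| funext fun R => R.covariant g a

/-- Restriction of linear functionals along the canonical embedding. -/
def restrict (Φ : CrossedProduct α →ₗ[ℂ] ℂ) : A →ₗ[ℂ] ℂ :=
  Φ ∘ₗ (ofAlgebra α).toAlgHom.toLinearMap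

end CrossedProduct

end CrossedProduct

end TracialRokhlin

end

open TracialRokhlin

/-! Everything rests on the vanishing `Φ (a λ_g) = 0` for `g ≠ 1` (`apply_mul_unitary_eq_zero`).
Injectivity follows because the span of the `a λ_g` is dense.

For the vanishing, let `τ` be the restriction of `Φ` to `A`, let `T` be its limit functional on the
ultrapower, and let `F` be that of `b ↦ Φ (a λ_g b)`; the goal is `F 1 = 0`. Two facts are used.
First, `‖F q‖ ≤ ‖a‖ T q` for positive `q`. Second, if `q` is positive and central with `α_g(q) q =
0`, then `F q = 0`: with `q = s²`, the trace moves one `s` around, which leaves `s a α_g(s) = a s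
α_g(s) = 0`. Split `1` into Rokhlin towers and a remainder. In a tower over `S`, only levels `h`
with `g h ∉ S` contribute, and invariance makes these an `ε`-fraction. The remainder contributes
little if everything Cuntz below `z` has small trace.

Such a `z` comes from repeated halving: two disjointly supported functions of one self-adjoint
element cannot both have more than half of the trace. Halving fails only if `A` has a minimal
projection (`hasSmallElement_or_exists_isMinimalProjection`). In that case central sequences are
scalar, all towers vanish, and every nonzero projection has trace at least `1`. This forces `A = ℂ`,
which is excluded (`not_isMinimalProjection`).

For surjectivity, an invariant trace `τ` extends to the vector functional of `δ_1 ⊗ ξ_τ` in the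
regular representation on `ℓ²(G, H_τ)`. It kills `a λ_g` for `g ≠ 1`, and invariance of `τ` makes it
tracial (`exists_tracial_extension`). -/

noncomputable section

namespace TracialRokhlin

universe u v w

/-! ### Positive elements and their square roots -/

section Positive

variable {B : Type u} [CStarAlgebra B]

/-- The commutation clause ensures that the root of a central sequence still commutes with `A`. -/
theorem IsPositiveElement.exists_sqrt {b : B} (hb : IsPositiveElement b) :
    ∃ s : B, IsSelfAdjoint s ∧ s * s = b ∧ ∀ x, Commute b x → Commute s x := by
  let _ := CStarAlgebra.spectralOrder B
  have := CStarAlgebra.spectralOrderedRing B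
  have hb' : 0 ≤ b := hb
  refine ⟨CFC.sqrt b, (CFC.sqrt_nonneg b).isSelfAdjoint, CFC.sqrt_mul_sqrt_self b hb', ?_⟩
  intro x hx
  exact hx.cfcₙ_nnreal _

theorem isPositiveElement_star_mul_self (s : B) : IsPositiveElement (star s * s) := by
  let _ := CStarAlgebra.spectralOrder B
  have := CStarAlgebra.spectralOrderedRing B
  exact star_mul_self_nonneg s

theorem IsPositiveElement.sum {ι : Type*} {s : Finset ι} {f : ι → B}
    (h : ∀ i ∈ s, IsPositiveElement (f i)) : IsPositiveElement (∑ i ∈ s, f i) := by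
  let _ := CStarAlgebra.spectralOrder B
  have := CStarAlgebra.spectralOrderedRing B
  exact Finset.sum_nonneg h

theorem IsPositiveElement.norm_le_one {a b : B} (ha : IsPositiveElement a)
    (hb : IsPositiveElement b) (hab : a + b = 1) : ‖a‖ ≤ 1 := by
  let _ := CStarAlgebra.spectralOrder B
  have := CStarAlgebra.spectralOrderedRing B
  have ha' : 0 ≤ a := ha
  have hb' : 0 ≤ b := hb
  rw [CStarAlgebra.norm_le_one_iff_of_nonneg a ha', ← hab]
  exact le_add_of_nonneg_right hb'

/-- If a square annihilates `x`, so does its self-adjoint root. -/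
theorem mul_eq_zero_of_mul_self_mul_eq_zero {s x : B} (hs : IsSelfAdjoint s)
    (h : s * s * x = 0) : s * x = 0 := by
  rw [← CStarRing.star_mul_self_eq_zero_iff, star_mul, hs.star_eq, mul_assoc, ← mul_assoc s, h,
    mul_zero]

end Positive

/-! ### Inequalities for positive tracial functionals -/

section Trace

variable {B : Type u} [CStarAlgebra B] {τ : B →ₗ[ℂ] ℂ}

theorem continuous_of_nonneg (hτ : ∀ x, 0 ≤ τ (star x * x)) : Continuous τ := by
  let _ := CStarAlgebra.spectralOrder B
  have := CStarAlgebra.spectralOrderedRing B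
  let f : B →ₚ[ℂ] ℂ := PositiveLinearMap.mk₀ τ (by
    intro x hx
    obtain ⟨s, hs, rfl, -⟩ := IsPositiveElement.exists_sqrt hx
    simpa [hs.star_eq] using hτ s)
  exact map_continuous f

theorem re_nonneg_of_isPositiveElement (hτ : ∀ x, 0 ≤ τ (star x * x)) {b : B}
    (hb : IsPositiveElement b) : 0 ≤ (τ b).re := by
  obtain ⟨s, hs, rfl, -⟩ := hb.exists_sqrt
  have := (Complex.le_def.1 (hτ s)).1
  rwa [hs.star_eq] at this

/-- The Cauchy--Schwarz inequality. -/
theorem norm_sq_star_mul_le (hτ : ∀ x, 0 ≤ τ (star x * x)) (u v : B) :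
    ‖τ (star u * v)‖ ^ 2 ≤ (τ (star u * u)).re * (τ (star v * v)).re := by
  let _ := CStarAlgebra.spectralOrder B
  have := CStarAlgebra.spectralOrderedRing B
  let f : B →ₚ[ℂ] ℂ := PositiveLinearMap.mk₀ τ (by
    intro x hx
    obtain ⟨s, hs, rfl, -⟩ := IsPositiveElement.exists_sqrt hx
    simpa [hs.star_eq] using hτ s)
  have h := norm_inner_le_norm (𝕜 := ℂ) (f.toPreGNS u) (f.toPreGNS v)
  have hu := (Complex.le_def.1 (hτ u)).1
  have hv := (Complex.le_def.1 (hτ v)).1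
  rw [f.preGNS_inner_def, f.preGNS_norm_def, f.preGNS_norm_def] at h
  have h' : ‖τ (star u * v)‖ ≤ √(τ (star u * u)).re * √(τ (star v * v)).re := h
  calc _ ≤ (√(τ (star u * u)).re * √(τ (star v * v)).re) ^ 2 := by gcongr
    _ = _ := by rw [mul_pow, Real.sq_sqrt hu, Real.sq_sqrt hv]

theorem re_conj_le (hτ : ∀ x, 0 ≤ τ (star x * x)) (x s : B) :
    (τ (star (x * s) * (x * s))).re ≤ ‖x‖ ^ 2 * (τ (star s * s)).re := by
  let _ := CStarAlgebra.spectralOrder B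
  have := CStarAlgebra.spectralOrderedRing B
  have h : star s * (star x * x) * s ≤ ‖star x * x‖ • (star s * s) :=
    CStarAlgebra.star_left_conjugate_le_norm_smul
  have h2 := re_nonneg_of_isPositiveElement hτ (b := _ - _) (sub_nonneg.2 h)
  rw [CStarRing.norm_star_mul_self, ← Complex.coe_smul, map_sub, map_smul] at h2
  simp only [Complex.sub_re, smul_eq_mul, Complex.re_ofReal_mul] at h2
  rw [star_mul, mul_assoc, ← mul_assoc (star x), ← mul_assoc, sq]
  linarith

/-- A positive tracial functional satisfies `|τ (x s⋆s)| ≤ ‖x‖ τ (s⋆s)`. -/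
theorem norm_mul_star_mul_self_le (hτ : ∀ x, 0 ≤ τ (star x * x))
    (hc : ∀ x y, τ (x * y) = τ (y * x)) (x s : B) :
    ‖τ (x * (star s * s))‖ ≤ ‖x‖ * (τ (star s * s)).re := by
  have h0 := (Complex.le_def.1 (hτ s)).1
  -- Traciality turns `x s⋆s` into `s x s⋆`, a form to which Cauchy–Schwarz applies with `u = s⋆`,
  -- `v = x s⋆`.
  have e : τ (x * (star s * s)) = τ (star (star s) * (x * star s)) := by
    rw [← mul_assoc, hc, star_star]
  have h1 := norm_sq_star_mul_le hτ (star s) (x * star s)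
  have h2 := re_conj_le hτ x (star s)
  rw [star_star, hc s (star s)] at h2
  rw [← e, star_star, hc s (star s)] at h1
  refine abs_le_of_sq_le_sq' ?_ (mul_nonneg (norm_nonneg _) h0) |>.2
  calc _ ≤ _ := h1
    _ ≤ (τ (star s * s)).re * (‖x‖ ^ 2 * (τ (star s * s)).re) := by gcongr
    _ = _ := by ring

/-- An element `y` acting as a unit on `z` bounds the trace of everything that is Cuntz below
`z`. -/
theorem re_le_of_cuntzSubequiv (hτ : ∀ x, 0 ≤ τ (star x * x))
    (hc : ∀ x y, τ (x * y) = τ (y * x)) {f z y : B} (hfz : CuntzSubequiv f z)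
    (hz : IsPositiveElement z) (hy : IsSelfAdjoint y) (hyz : y * z = z) :
    (τ f).re ≤ ‖f‖ * (τ (y * y)).re := by
  obtain ⟨s, hs, rfl, -⟩ := hz.exists_sqrt
  obtain ⟨r, hr⟩ := hfz
  have hys : y * s = s := by
    have h1 : s * s * (1 - y) = 0 := by
      have := congrArg star hyz
      rw [star_mul, star_mul, hs.star_eq, hy.star_eq] at this
      rw [mul_sub, this, mul_one, sub_self]
    have h2 := congrArg star (mul_eq_zero_of_mul_self_mul_eq_zero hs h1)
    rw [star_mul, star_sub, hs.star_eq, hy.star_eq, star_one, star_zero, sub_mul, one_mul,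
      sub_eq_zero] at h2
    exact h2.symm
  have hsy : s * y = s := by
    have := congrArg star hys
    rwa [star_mul, hs.star_eq, hy.star_eq] at this
  -- With `x = r s` and `z = s²`, the approximant is `x x⋆`. It has the norm and trace of `x⋆x = y
  -- x⋆x y`, whose trace is that of `x⋆x y²`.
  have key : ∀ n, (τ (r n * (s * s) * star (r n))).re ≤
      ‖r n * (s * s) * star (r n)‖ * (τ (y * y)).re := by
    intro n
    set x := r n * s with hx
    have e1 : r n * (s * s) * star (r n) = x * star x := by
      rw [hx, star_mul, hs.star_eq]; simp only [mul_assoc]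
    have e2 : star x * x = y * (star x * x) * y := by
      rw [hx, star_mul, hs.star_eq]
      have : y * (s * star (r n) * (r n * s)) * y
        = (y * s) * star (r n) * (r n * (s * y)) := by simp only [mul_assoc]
      rw [this, hys, hsy]
    have e3 : ‖x * star x‖ = ‖star x * x‖ := by
      rw [CStarRing.norm_self_mul_star, CStarRing.norm_star_mul_self]
    rw [e1, e3, hc]
    have e4 : τ (star x * x) = τ (star x * x * (star y * y)) := by
      conv_lhs => rw [e2, hc]
      rw [hc, hy.star_eq, mul_assoc, hc]
      simp only [mul_assoc]
    have h := norm_mul_star_mul_self_le hτ hc (star x * x) y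
    rw [← e4, hy.star_eq] at h
    exact (Complex.re_le_norm _).trans h
  have hcont := continuous_of_nonneg hτ
  have l1 := (Complex.continuous_re.comp hcont).continuousAt.tendsto.comp hr
  have l2 := (hr.norm).mul_const (τ (y * y)).re
  exact le_of_tendsto_of_tendsto' l1 l2 key

end Trace

/-! ### Elements of small trace, or a minimal projection -/

section SmallElements

variable {B : Type u} [CStarAlgebra B]

theorem exists_two_spectrum_points {c : B} (hc : IsSelfAdjoint c)
    (h : ¬ ∃ t : ℝ, c * c = t • c) :
    ∃ s ∈ spectrum ℝ c, ∃ t ∈ spectrum ℝ c, s ≠ 0 ∧ t ≠ 0 ∧ s ≠ t := by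
  by_contra! hst
  apply h
  obtain ⟨t, ht⟩ : ∃ t : ℝ, ∀ s ∈ spectrum ℝ c, s = 0 ∨ s = t := by
    by_cases h0 : ∃ t ∈ spectrum ℝ c, t ≠ 0
    · obtain ⟨t, ht, ht0⟩ := h0
      refine ⟨t, fun s hs => or_iff_not_imp_left.2 fun hs0 => hst s hs t ht hs0 ht0⟩
    · push Not at h0
      exact ⟨0, fun s hs => Or.inl (h0 s hs)⟩
  refine ⟨t, ?_⟩
  -- On a spectrum contained in `{0, t}` the functions `x²` and `t x` agree.
  have e : cfc (fun x : ℝ => x * x) c = cfc (fun x : ℝ => t * x) c := by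
    refine cfc_congr fun s hs => ?_
    rcases ht s hs with rfl | rfl <;> simp
  rw [cfc_mul (fun x : ℝ => x) (fun x => x) c, cfc_const_mul t (fun x : ℝ => x) c,
    cfc_id' ℝ c] at e
  exact e

/-- The tent function of height `1` around `s`. -/
def tent (r s x : ℝ) : ℝ := max 0 (min 1 (2 - 2 * |x - s| / r))

theorem continuous_tent (r s : ℝ) : Continuous (tent r s) := by unfold tent; fun_prop

theorem tent_nonneg (r s x : ℝ) : 0 ≤ tent r s x := le_max_left _ _

theorem tent_le_one (r s x : ℝ) : tent r s x ≤ 1 := max_le zero_le_one (min_le_left _ _)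

theorem tent_eq_zero {r s x : ℝ} (hr : 0 < r) (h : r ≤ |x - s|) : tent r s x = 0 := by
  refine max_eq_left ((min_le_right _ _).trans ?_)
  rw [sub_nonpos, le_div_iff₀ hr]
  linarith

theorem tent_eq_one {r s x : ℝ} (hr : 0 < r) (h : |x - s| ≤ r / 2) : tent r s x = 1 := by
  have : 2 * |x - s| / r ≤ 1 := by rw [div_le_iff₀ hr]; linarith
  rw [tent, min_eq_left (by linarith), max_eq_right zero_le_one]

theorem tent_sq_add_tent_sq_le {r s t : ℝ} (hr : 0 < r) (hst : 2 * r ≤ |s - t|) (x : ℝ) :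
    tent r s x * tent r s x + tent r t x * tent r t x ≤ 1 := by
  have h1 := tent_nonneg r s x
  have h2 := tent_le_one r s x
  have h3 := tent_nonneg r t x
  have h4 := tent_le_one r t x
  rcases le_or_gt r |x - s| with h | h
  · rw [tent_eq_zero hr h]; nlinarith
  · rw [tent_eq_zero (s := t) hr ?_]
    · nlinarith
    · have := abs_sub_le s x t
      rw [abs_sub_comm s x] at this
      linarith

/-- The tent vanishes near `0`, so it is divisible by `x`; its value at `c` lies in `c B`, where `y`
acts as a left unit. The `max` keeps the quotient continuous at `0`. -/
theorem mul_cfc_tent {y c : B} (hc : IsSelfAdjoint c) (hyc : y * c = c) {r s : ℝ} (hr : 0 < r)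
    (hs : 2 * r ≤ |s|) : y * cfc (tent r s) c = cfc (tent r s) c := by
  have e : cfc (tent r s) c = c * cfc (fun x => tent r s x * (x / max (x * x) (r * r))) c := by
    have hpos : ∀ x : ℝ, max (x * x) (r * r) ≠ 0 := fun x =>
      (lt_of_lt_of_le (by positivity) (le_max_right _ _)).ne'
    have hcont : Continuous fun x => tent r s x * (x / max (x * x) (r * r)) := by
      have := continuous_tent r s
      exact this.mul (continuous_id.div₀ (by fun_prop) hpos)
    conv_rhs => enter [1]; rw [← cfc_id' ℝ c]
    rw [← cfc_mul (fun x : ℝ => x) _ c (by fun_prop) hcont.continuousOn]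
    refine cfc_congr fun x _ => ?_
    rcases le_or_gt r |x| with h | h
    · have hx : r * r ≤ x * x := by
        rw [← abs_mul_abs_self x]; gcongr
      have hx0 : x ≠ 0 := by rintro rfl; simp at h; linarith
      rw [max_eq_left hx]
      field_simp
    · have : tent r s x = 0 := by
        apply tent_eq_zero hr
        have := abs_sub_abs_le_abs_sub s x
        rw [abs_sub_comm s x] at this
        linarith
      simp [this]
  rw [e, ← mul_assoc, hyc]

/-- A nonzero positive `z` with a self-adjoint local unit `y` of small trace. -/
def HasSmallElement (τ : B →ₗ[ℂ] ℂ) (δ : ℝ) : Prop :=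
  ∃ z y : B, IsPositiveElement z ∧ z ≠ 0 ∧ IsSelfAdjoint y ∧ y * z = z ∧ (τ (y * y)).re ≤ δ

/-- Tents around two nonzero spectral points give `a`, `b` with `a² + b² ≤ 1`, both fixed by `y`.
Hence `τ(a²) + τ(b²) ≤ τ(y²)`, and one of them is a local unit of at most half the size. -/
theorem hasSmallElement_half {τ : B →ₗ[ℂ] ℂ} (hτ : ∀ x, 0 ≤ τ (star x * x)) {y c : B}
    (hc : IsSelfAdjoint c) (hy : IsSelfAdjoint y) (hyc : y * c = c)
    (h : ¬ ∃ t : ℝ, c * c = t • c) {δ : ℝ} (hδ : (τ (y * y)).re ≤ δ) :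
    HasSmallElement τ (δ / 2) := by
  let _ := CStarAlgebra.spectralOrder B
  have := CStarAlgebra.spectralOrderedRing B
  obtain ⟨s, hs, t, ht, hs0, ht0, hst⟩ := exists_two_spectrum_points hc h
  obtain ⟨r, hr, hrs, hrt, hrst⟩ : ∃ r : ℝ, 0 < r ∧ 2 * r ≤ |s| ∧ 2 * r ≤ |t| ∧
      2 * r ≤ |s - t| := by
    have hs' := abs_pos.2 hs0
    have ht' := abs_pos.2 ht0
    have hst' := abs_pos.2 (sub_ne_zero.2 hst)
    refine ⟨min |s| (min |t| |s - t|) / 2, by positivity, ?_, ?_, ?_⟩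
    · linarith [min_le_left |s| (min |t| |s - t|)]
    · linarith [min_le_right |s| (min |t| |s - t|), min_le_left |t| |s - t|]
    · linarith [min_le_right |s| (min |t| |s - t|), min_le_right |t| |s - t|]
  -- The new `z` is a bump supported where the tent equals `1`; it is nonzero because it takes the
  -- value `r / 2` at the spectral point `s`.
  have small : ∀ s ∈ spectrum ℝ c, (τ (cfc (tent r s) c * cfc (tent r s) c)).re ≤ δ / 2 → HasSmallElement τ (δ / 2) := by
    intro s hs hle
    have hfc : Continuous fun x : ℝ => max 0 (r / 2 - |x - s|) := by fun_prop
    refine ⟨cfc (fun x : ℝ => max 0 (r / 2 - |x - s|)) c, cfc (tent r s) c,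
      cfc_nonneg fun x _ => le_max_left _ _, ?_, cfc_predicate _ _, ?_, hle⟩
    · intro h0
      rw [← cfc_zero ℝ c] at h0
      have := eqOn_of_cfc_eq_cfc (R := ℝ) (a := c) h0 hfc.continuousOn continuousOn_const hc hs
      simp at this
      linarith
    · rw [← cfc_mul (tent r s) _ c (continuous_tent r s).continuousOn hfc.continuousOn]
      refine cfc_congr fun x _ => ?_
      rcases le_total |x - s| (r / 2) with h | h
      · simp [tent_eq_one hr h]
      · have : max 0 (r / 2 - |x - s|) = 0 := max_eq_left (by linarith)
        simp [this]
  set a := cfc (tent r s) c with ha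
  set b := cfc (tent r t) c with hb
  have hya : y * a = a := mul_cfc_tent hc hyc hr hrs
  have hyb : y * b = b := mul_cfc_tent hc hyc hr hrt
  have hay : a * y = a := by
    have := congrArg star hya
    rwa [star_mul, (cfc_predicate (tent r s) c : IsSelfAdjoint a).star_eq, hy.star_eq] at this
  have hby : b * y = b := by
    have := congrArg star hyb
    rwa [star_mul, (cfc_predicate (tent r t) c : IsSelfAdjoint b).star_eq, hy.star_eq] at this
  have hsum : a * a + b * b ≤ 1 := by
    have c1 := (continuous_tent r s).continuousOn (s := spectrum ℝ c)
    have c2 := (continuous_tent r t).continuousOn (s := spectrum ℝ c)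
    rw [ha, hb, ← cfc_mul (tent r s) (tent r s) c c1 c1, ← cfc_mul (tent r t) (tent r t) c c2 c2,
      ← cfc_add c (fun x => tent r s x * tent r s x) (fun x => tent r t x * tent r t x)
        (c1.mul c1) (c2.mul c2)]
    exact cfc_le_one _ _ fun x _ => tent_sq_add_tent_sq_le hr hrst x
  obtain ⟨w, hw, hww, -⟩ := IsPositiveElement.exists_sqrt (b := 1 - (a * a + b * b))
    (sub_nonneg.2 hsum)
  -- Positivity of `τ` on `y (1 - a² - b²) y = y² - a² - b²`.
  have h1 := (Complex.le_def.1 (hτ (w * y))).1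
  have e : star (w * y) * (w * y) = y * y - a * a - b * b := by
    calc star (w * y) * (w * y) = y * (w * w) * y := by
          rw [star_mul, hw.star_eq, hy.star_eq]; simp only [mul_assoc]
      _ = y * y - (y * a) * (a * y) - (y * b) * (b * y) := by
          rw [hww]; noncomm_ring
      _ = _ := by rw [hya, hyb, hay, hby]
  rw [e, map_sub, map_sub, Complex.sub_re, Complex.sub_re, Complex.zero_re] at h1
  by_cases hcase : (τ (a * a)).re ≤ δ / 2
  · exact small s hs hcase
  · exact small t ht (by linarith)

/-- A nonzero projection `p` with `p B p = ℂ p`. -/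
def IsMinimalProjection (p : B) : Prop :=
  IsSelfAdjoint p ∧ p * p = p ∧ p ≠ 0 ∧ ∀ b, ∃ c : ℂ, p * b * p = c • p

/-- Subtracting the relation for `k = 0` from that for `k` expresses a multiple of `c` through `p`.
The multiple can be zero for a nonzero `k` only if `t = -k`, so `k = 1` and `k = 2` cannot both
fail. -/
theorem exists_smul_eq_of_sq {p c : B} (hp : p * p = p) (hp0 : p ≠ 0) (hpc : p * c = c)
    (hcp : c * p = c) (h : ∀ k : ℝ, ∃ t : ℝ, (c + k • p) * (c + k • p) = t • (c + k • p)) :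
    ∃ γ : ℝ, c = γ • p := by
  have key : ∀ k : ℝ, ∃ t : ℝ, c * c + (2 * k - t) • c = (t * k - k * k) • p := by
    intro k
    obtain ⟨t, ht⟩ := h k
    refine ⟨t, ?_⟩
    have e : (c + k • p) * (c + k • p) = c * c + (2 * k) • c + (k * k) • p := by
      simp only [add_mul, mul_add, smul_mul_assoc, mul_smul_comm, hp, hpc, hcp]
      module
    rw [e] at ht
    have : c * c = t • (c + k • p) - (2 * k) • c - (k * k) • p := by rw [← ht]; abel
    rw [this]
    module
  obtain ⟨t, h0⟩ := key 0
  have h0' : c * c = t • c := by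
    simp only [mul_zero, zero_sub, sub_zero, zero_smul, neg_smul] at h0
    rwa [← sub_eq_add_neg, sub_eq_zero] at h0
  have solve : ∀ k t' : ℝ, c * c + (2 * k - t') • c = (t' * k - k * k) • p →
      t + 2 * k - t' ≠ 0 → ∃ γ : ℝ, c = γ • p := by
    intro k t' h1 hne
    rw [h0', ← add_smul] at h1
    refine ⟨(t + 2 * k - t')⁻¹ * (t' * k - k * k), ?_⟩
    rw [mul_smul, ← h1, smul_smul, ← add_sub_assoc, inv_mul_cancel₀ hne, one_smul]
  have degenerate : ∀ k t' : ℝ, c * c + (2 * k - t') • c = (t' * k - k * k) • p →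
      t + 2 * k - t' = 0 → t' * k - k * k = 0 := by
    intro k t' h1 he
    rw [h0', ← add_smul, ← add_sub_assoc, he, zero_smul] at h1
    exact (smul_eq_zero.1 h1.symm).resolve_right hp0
  obtain ⟨t₁, h1⟩ := key 1
  obtain ⟨t₂, h2⟩ := key 2
  by_cases e1 : t + 2 * 1 - t₁ = 0
  · by_cases e2 : t + 2 * 2 - t₂ = 0
    · have d1 := degenerate 1 t₁ h1 e1
      have d2 := degenerate 2 t₂ h2 e2
      exfalso; linarith
    · exact solve 2 t₂ h2 e2
  · exact solve 1 t₁ h1 e1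

/-- Taking `b = 1` gives `z⁴ = t z²`, so `t⁻¹ z²` is a projection. Each self-adjoint element of its
corner, shifted by any multiple of the unit of the corner, again has the form `z b z`. -/
theorem exists_isMinimalProjection {z : B} (hz : IsSelfAdjoint z) (hz0 : z ≠ 0)
    (h : ∀ b, IsSelfAdjoint b → ∃ t : ℝ, (z * b * z) * (z * b * z) = t • (z * b * z)) :
    ∃ p : B, IsMinimalProjection p := by
  have hzz0 : z * z ≠ 0 := by
    intro h0
    apply hz0
    rw [← CStarRing.star_mul_self_eq_zero_iff, hz.star_eq, h0]
  have hzz : IsSelfAdjoint (z * z) := by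
    have := IsSelfAdjoint.star_mul_self z
    rwa [hz.star_eq] at this
  obtain ⟨t, ht⟩ := h 1 (.one B)
  rw [mul_one] at ht
  have ht0 : t ≠ 0 := by
    rintro rfl
    apply hzz0
    rw [← CStarRing.star_mul_self_eq_zero_iff, hzz.star_eq, ht, zero_smul]
  obtain ⟨p, hp⟩ : ∃ p, p = t⁻¹ • (z * z) := ⟨_, rfl⟩
  have hpsa : IsSelfAdjoint p := hp ▸ IsSelfAdjoint.smul (.all _) hzz
  have hpp : p * p = p := by
    rw [hp, smul_mul_smul_comm, ht, smul_smul, mul_assoc, inv_mul_cancel₀ ht0, mul_one]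
  have hp0 : p ≠ 0 := hp ▸ smul_ne_zero (inv_ne_zero ht0) hzz0
  have hsa : ∀ b, IsSelfAdjoint b → ∃ γ : ℝ, p * b * p = γ • p := by
    intro b hb
    refine exists_smul_eq_of_sq hpp hp0 (by simp only [← mul_assoc, hpp])
      (by simp only [mul_assoc, hpp]) fun k => ?_
    have e : p * b * p + k • p =
        z * ((t⁻¹ * t⁻¹) • (z * (b + k • 1) * z)) * z := by
      have : p * b * p + k • p = p * (b + k • 1) * p := by
        rw [mul_add, add_mul, mul_smul_comm, mul_one, smul_mul_assoc, hpp]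
      rw [this, hp]
      simp only [smul_mul_assoc, mul_smul_comm, smul_smul, mul_assoc]
    rw [e]
    refine h _ (IsSelfAdjoint.smul (.all _) ?_)
    have := (hb.add (IsSelfAdjoint.smul (.all k) (.one B))).conjugate z
    rwa [hz.star_eq] at this
  refine ⟨p, hpsa, hpp, hp0, fun b => ?_⟩
  obtain ⟨γ₁, h1⟩ := hsa (realPart b) (realPart b).2
  obtain ⟨γ₂, h2⟩ := hsa (imaginaryPart b) (imaginaryPart b).2
  refine ⟨(γ₁ : ℂ) + Complex.I * γ₂, ?_⟩
  conv_lhs => rw [← realPart_add_I_smul_imaginaryPart b]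
  rw [mul_add, add_mul, h1, mul_smul_comm, smul_mul_assoc, h2, add_smul, mul_smul,
    Complex.coe_smul, Complex.coe_smul]

theorem hasSmallElement_or_exists_isMinimalProjection [Nontrivial B] {τ : B →ₗ[ℂ] ℂ}
    (hτ : ∀ x, 0 ≤ τ (star x * x)) (h1 : τ 1 = 1) :
    (∃ p : B, IsMinimalProjection p) ∨ ∀ δ > 0, HasSmallElement τ δ := by
  by_cases hp : ∃ p : B, IsMinimalProjection p
  · exact Or.inl hp
  right
  have step : ∀ n : ℕ, HasSmallElement τ ((1 / 2) ^ n) := by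
    intro n
    induction n with
    | zero =>
      refine ⟨1, 1, ?_, one_ne_zero, .one B, one_mul 1, ?_⟩
      · simpa using isPositiveElement_star_mul_self (1 : B)
      · simp [h1]
    | succ n ih =>
      obtain ⟨z, y, hz, hz0, hy, hyz, hle⟩ := ih
      have hzsa : IsSelfAdjoint z := by
        obtain ⟨s, hs, rfl, -⟩ := hz.exists_sqrt
        have := IsSelfAdjoint.star_mul_self s
        rwa [hs.star_eq] at this
      -- If no halving is possible, no self-adjoint `z b z` has two distinct nonzero spectral
      -- values, and a minimal projection appears.
      by_contra hcon
      refine hp (exists_isMinimalProjection hzsa hz0 fun b hb => ?_)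
      by_contra hb'
      apply hcon
      rw [pow_succ, mul_one_div]
      refine hasSmallElement_half hτ (c := z * b * z) ?_ hy ?_ hb' hle
      · have := hb.conjugate z
        rwa [hzsa.star_eq] at this
      · rw [← mul_assoc, ← mul_assoc, hyz]
  intro δ hδ
  obtain ⟨n, hn⟩ := exists_pow_lt_of_lt_one hδ (by norm_num : (1 / 2 : ℝ) < 1)
  obtain ⟨z, y, hz, hz0, hy, hyz, hle⟩ := step n
  exact ⟨z, y, hz, hz0, hy, hyz, hle.trans hn.le⟩

end SmallElements

/-! ### Limit functionals and induced maps on the ultrapower -/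

section UltrapowerMaps

variable {ω : Ultrafilter ℕ} {A : Type u} [CStarAlgebra A]

/-- The functional `[(x n)] ↦ lim_{n → ω} ψ (x n)` on the ultrapower. -/
theorem exists_limit_functional (ω : Ultrafilter ℕ) {ψ : A →ₗ[ℂ] ℂ} (hψ : Continuous ψ) :
    ∃ Ψ : Ultrapower ω A →ₗ[ℂ] ℂ, ∀ x : ℕ →ᵇ A,
      Filter.Tendsto (fun n => ψ (x n)) ω (nhds (Ψ (Ultrapower.mk ω A x))) := by
  let ψ' : A →L[ℂ] ℂ := ⟨ψ, hψ⟩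
  have hlim : ∀ x : ℕ →ᵇ A, ∃ l, Filter.Tendsto (fun n => ψ (x n)) ω (nhds l) := by
    intro x
    have hK := isCompact_closedBall (0 : ℂ) (‖ψ'‖ * ‖x‖)
    -- The values stay in a compact disc, where every ultrafilter converges.
    obtain ⟨l, -, hl⟩ := hK.ultrafilter_le_nhds (ω.map fun n => ψ (x n)) (by
      rw [Filter.le_principal_iff]
      refine Filter.mem_map.2 (Filter.univ_mem' fun n => mem_closedBall_zero_iff.2 ?_)
      exact ψ'.le_opNorm_of_le (x.norm_coe_le_norm n))
    exact ⟨l, hl⟩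
  choose L hL using hlim
  have hwd : ∀ x y, Ultrapower.mk ω A x = Ultrapower.mk ω A y → L x = L y := by
    intro x y hxy
    have h0 : Filter.Tendsto (fun n => (x - y) n) ω (nhds 0) :=
      tendsto_zero_iff_norm_tendsto_zero.2 (Ultrapower.mk_eq_mk.1 hxy)
    have h1 := (hψ.tendsto 0).comp h0
    rw [map_zero] at h1
    have h2 := h1.add (hL y)
    rw [zero_add] at h2
    refine tendsto_nhds_unique (hL x) (h2.congr fun n => ?_)
    simp
  -- The limit depends only on the class, so an arbitrary, nonlinear choice of representatives still
  -- gives a linear map.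
  choose σ hσ using (Ultrapower.mk_surjective : Function.Surjective (Ultrapower.mk ω A))
  refine ⟨{ toFun := fun ξ => L (σ ξ), map_add' := ?_, map_smul' := ?_ }, fun x => ?_⟩
  · intro ξ η
    rw [hwd (σ (ξ + η)) (σ ξ + σ η) (by rw [map_add, hσ, hσ, hσ])]
    refine tendsto_nhds_unique (hL _) (((hL (σ ξ)).add (hL (σ η))).congr fun n => ?_)
    simp
  · intro c ξ
    rw [hwd (σ (c • ξ)) (c • σ ξ) (by rw [map_smul, hσ, hσ])]
    refine tendsto_nhds_unique (hL _) (((hL (σ ξ)).const_smul c).congr fun n => ?_)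
    simp
  · have : L (σ (Ultrapower.mk ω A x)) = L x := hwd _ _ (hσ _)
    simpa [this] using hL x

variable (ω A) in
theorem norm_constEmbedding_le (a : A) : ‖constEmbedding ω A a‖ ≤ ‖a‖ :=
  (Ultrapower.norm_mk_le _).trans (BoundedContinuousFunction.norm_const_le a)

variable (ω A) in
/-- The embedding of `A` in `A^ω` as a ⋆-homomorphism. -/
def constEmbeddingHom : A →⋆ₐ[ℂ] Ultrapower ω A where
  toFun := constEmbedding ω A
  map_one' := map_one (Ultrapower.mk ω A)
  map_mul' a b := map_mul (Ultrapower.mk ω A) (.const ℕ a) (.const ℕ b)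
  map_zero' := map_zero (Ultrapower.mk ω A)
  map_add' a b := map_add (Ultrapower.mk ω A) (.const ℕ a) (.const ℕ b)
  commutes' c := (Ultrapower.mk ω A).commutes c
  map_star' _ := rfl

/-- The extension of an automorphism of `A` to `A^ω` as a ⋆-homomorphism. -/
def ultrapowerHom (φ : A ≃⋆ₐ[ℂ] A) : Ultrapower ω A →⋆ₐ[ℂ] Ultrapower ω A where
  toFun := ultrapowerMap φ
  map_one' := by
    rw [← map_one (Ultrapower.mk ω A), ultrapowerMap_mk]
    congr 1; ext n; exact map_one φ
  map_mul' x y := by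
    obtain ⟨x, rfl⟩ := Ultrapower.mk_surjective x
    obtain ⟨y, rfl⟩ := Ultrapower.mk_surjective y
    rw [← map_mul, ultrapowerMap_mk, ultrapowerMap_mk, ultrapowerMap_mk, ← map_mul]
    congr 1; ext n; exact map_mul φ _ _
  map_zero' := by
    rw [← map_zero (Ultrapower.mk ω A), ultrapowerMap_mk]
    congr 1; ext n; exact map_zero φ
  map_add' x y := by
    obtain ⟨x, rfl⟩ := Ultrapower.mk_surjective x
    obtain ⟨y, rfl⟩ := Ultrapower.mk_surjective y
    rw [← map_add, ultrapowerMap_mk, ultrapowerMap_mk, ultrapowerMap_mk, ← map_add]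
    congr 1; ext n; exact map_add φ _ _
  commutes' c := by
    rw [← (Ultrapower.mk ω A).commutes c, ultrapowerMap_mk]
    congr 1; ext n
    change φ (algebraMap ℂ A c) = algebraMap ℂ A c
    exact AlgHomClass.commutes φ c
  map_star' x := by
    obtain ⟨x, rfl⟩ := Ultrapower.mk_surjective x
    rw [Ultrapower.star_mk, ultrapowerMap_mk, ultrapowerMap_mk, Ultrapower.star_mk]
    congr 1; ext n; exact map_star φ _

theorem ultrapowerHom_apply (φ : A ≃⋆ₐ[ℂ] A) (x : Ultrapower ω A) :
    ultrapowerHom φ x = ultrapowerMap φ x := rfl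

theorem ultrapowerHom_constEmbedding (φ : A ≃⋆ₐ[ℂ] A) (a : A) :
    ultrapowerHom φ (constEmbedding ω A a) = constEmbedding ω A (φ a) := rfl

theorem ultrapowerHom_mul {G : Type v} [Group G] (α : G →* (A ≃⋆ₐ[ℂ] A)) (g h : G)
    (x : Ultrapower ω A) :
    ultrapowerHom (α (g * h)) x = ultrapowerHom (α g) (ultrapowerHom (α h) x) := by
  obtain ⟨x, rfl⟩ := Ultrapower.mk_surjective x
  simp only [ultrapowerHom_apply, ultrapowerMap_mk]
  congr 1; ext n
  change α (g * h) (x n) = α g (α h (x n))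
  rw [map_mul]; rfl

theorem ultrapowerHom_mem_centralSequenceAlgebra (φ : A ≃⋆ₐ[ℂ] A) {x : Ultrapower ω A}
    (hx : x ∈ centralSequenceAlgebra ω A) :
    ultrapowerHom φ x ∈ centralSequenceAlgebra ω A := by
  rintro _ ⟨a, rfl⟩
  have h := congrArg (ultrapowerHom φ) (hx _ ⟨φ.symm a, rfl⟩)
  rwa [map_mul, map_mul, ultrapowerHom_constEmbedding, StarAlgEquiv.apply_symm_apply] at h

theorem IsPositiveElement.map {B C : Type*} [CStarAlgebra B] [CStarAlgebra C] (φ : B →⋆ₐ[ℂ] C)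
    {b : B} (hb : IsPositiveElement b) : IsPositiveElement (φ b) := by
  obtain ⟨s, hs, rfl, -⟩ := hb.exists_sqrt
  rw [map_mul]
  have := isPositiveElement_star_mul_self (φ s)
  rwa [← map_star, hs.star_eq] at this

/-- The limit functional of a positive functional is positive. -/
theorem limit_functional_nonneg {ψ : A →ₗ[ℂ] ℂ} (hψ : ∀ x, 0 ≤ ψ (star x * x))
    {Ψ : Ultrapower ω A →ₗ[ℂ] ℂ}
    (hΨ : ∀ x : ℕ →ᵇ A, Filter.Tendsto (fun n => ψ (x n)) ω (nhds (Ψ (Ultrapower.mk ω A x))))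
    (x : Ultrapower ω A) : 0 ≤ Ψ (star x * x) := by
  obtain ⟨x, rfl⟩ := Ultrapower.mk_surjective x
  rw [Ultrapower.star_mk, ← map_mul]
  exact ge_of_tendsto' (hΨ _) fun n => hψ (x n)

/-- A bounded sequence of positive elements represents a positive element of the ultrapower. -/
theorem isPositiveElement_mk {x : ℕ →ᵇ A} (hx : ∀ n, IsPositiveElement (x n)) :
    IsPositiveElement (Ultrapower.mk ω A x) := by
  choose s hs hss _ using fun n => (hx n).exists_sqrt
  let y : ℕ →ᵇ A := BoundedContinuousFunction.ofNormedAddCommGroup s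
    continuous_of_discreteTopology √‖x‖ (fun n => by
      refine Real.le_sqrt_of_sq_le ?_
      rw [sq, ← CStarRing.norm_star_mul_self, (hs n).star_eq, hss]
      exact x.norm_coe_le_norm n)
  have : x = star y * y := by
    ext n
    change x n = star (s n) * s n
    rw [(hs n).star_eq, hss]
  rw [this, map_mul, ← Ultrapower.star_mk]
  exact isPositiveElement_star_mul_self _

end UltrapowerMaps

/-! ### Counting in almost invariant sets -/

section InvariantSet

variable {G : Type v} [Group G]

open Classical in
-- The inverse is needed because `T ∩ g⁻¹T` consists of the `h ∈ T` with `g h ∈ T`.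
theorem IsInvariantSet.card_filter_le {g : G} {ε : ℝ} {T : Finset G}
    (hT : IsInvariantSet {g⁻¹} ε T) :
    ((T.filter fun h => g * h ∉ T).card : ℝ) ≤ ε * T.card := by
  have h1 := hT.2
  have e : ((T : Set G) ∩ ⋂ k ∈ ({g⁻¹} : Finset G), k • (T : Set G)) =
      ((T.filter fun h => g * h ∈ T : Finset G) : Set G) := by
    ext h
    simp [Set.mem_smul_set_iff_inv_smul_mem]
  rw [e, Set.ncard_coe_finset] at h1
  have h2 := Finset.card_filter_add_card_filter_not (s := T) (fun h => g * h ∈ T)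
  have h3 : ((T.filter fun h => g * h ∈ T).card : ℝ) + ((T.filter fun h => g * h ∉ T).card : ℝ)
      = T.card := by exact_mod_cast h2
  linarith

theorem IsInvariantSet.exists_mul_mem {g : G} {ε : ℝ} (hε : ε < 1) {T : Finset G}
    (hT : IsInvariantSet {g⁻¹} ε T) : ∃ h ∈ T, g * h ∈ T := by
  classical
  by_contra! hcon
  have h1 := hT.card_filter_le
  rw [Finset.filter_true_of_mem hcon] at h1
  have : (0 : ℝ) < T.card := by exact_mod_cast hT.1.card_pos
  nlinarith

end InvariantSet

/-! ### Excluding minimal projections -/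

section MinimalProjection

variable {ω : Ultrafilter ℕ} {A : Type u} [CStarAlgebra A]

/-- Centrality of `d` makes its annihilator in `A` a closed two-sided ideal. It contains `p ≠ 0`, so
by simplicity it contains `1`. -/
theorem eq_zero_of_mul_constEmbedding_eq_zero (hA : IsSimpleCStarAlgebra A)
    {d : Ultrapower ω A} (hd : d ∈ centralSequenceAlgebra ω A) {p : A} (hp : p ≠ 0)
    (h : d * constEmbedding ω A p = 0) : d = 0 := by
  let ι := constEmbeddingHom ω A
  have hcomm : ∀ a, ι a * d = d * ι a := fun a => hd _ ⟨a, rfl⟩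
  let I : TwoSidedIdeal A := TwoSidedIdeal.mk' {a | d * ι a = 0}
    (by simp)
    (by
      intro x y hx hy
      rw [Set.mem_ofPred_eq] at hx hy ⊢
      rw [map_add, mul_add, hx, hy, add_zero])
    (by
      intro x hx
      rw [Set.mem_ofPred_eq] at hx ⊢
      rw [map_neg, mul_neg, hx, neg_zero])
    (by
      intro x y hy
      rw [Set.mem_ofPred_eq] at hy ⊢
      rw [map_mul, ← mul_assoc, ← hcomm, mul_assoc, hy, mul_zero])
    (by
      intro x y hx
      rw [Set.mem_ofPred_eq] at hx ⊢
      rw [map_mul, ← mul_assoc, hx, zero_mul])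
  have hI : ∀ a, a ∈ I ↔ d * ι a = 0 := fun a => TwoSidedIdeal.mem_mk' ..
  have hcl : IsClosed (I : Set A) := by
    have : (I : Set A) = {a | d * ι a = 0} := Set.ext hI
    rw [this]
    have hι : Continuous ι := AddMonoidHomClass.continuous_of_bound ι 1 fun a => by
      rw [one_mul]; exact norm_constEmbedding_le ω A a
    exact isClosed_eq (by fun_prop) continuous_const
  rcases hA.2 I hcl with h0 | h0
  · have hpI : p ∈ I := (hI p).2 h
    rw [h0, TwoSidedIdeal.mem_bot] at hpI
    exact absurd hpI hp
  · have h1 : (1 : A) ∈ I := by rw [h0]; trivial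
    rw [hI, map_one, mul_one] at h1
    exact h1

/-- In the presence of a minimal projection, a simple C⋆-algebra has only trivial central
sequences. -/
theorem IsMinimalProjection.exists_eq_smul_one (hA : IsSimpleCStarAlgebra A) {p : A}
    (hp : IsMinimalProjection p) {e : Ultrapower ω A} (he : e ∈ centralSequenceAlgebra ω A) :
    ∃ c : ℂ, e = c • 1 := by
  obtain ⟨-, hpp, hp0, hmin⟩ := hp
  obtain ⟨x, rfl⟩ := Ultrapower.mk_surjective e
  choose c hc using fun n => hmin (x n)
  have hnp : 0 < ‖p‖ := norm_pos_iff.2 hp0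
  have hbd : ∀ n, ‖c n‖ ≤ ‖x‖ * ‖p‖ := by
    intro n
    have h1 : ‖c n‖ * ‖p‖ ≤ ‖x‖ * ‖p‖ * ‖p‖ := by
      rw [← norm_smul, ← hc n]
      calc ‖p * x n * p‖ ≤ ‖p‖ * ‖x n‖ * ‖p‖ := norm_mul₃_le
        _ ≤ ‖p‖ * ‖x‖ * ‖p‖ := by gcongr; exact x.norm_coe_le_norm n
        _ = _ := by ring
    exact le_of_mul_le_mul_right h1 hnp
  obtain ⟨l, -, hl⟩ := (isCompact_closedBall (0 : ℂ) (‖x‖ * ‖p‖)).ultrafilter_le_nhds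
    (ω.map c) (by
      rw [Filter.le_principal_iff]
      exact Filter.mem_map.2 (Filter.univ_mem' fun n => mem_closedBall_zero_iff.2 (hbd n)))
  have hl' : Filter.Tendsto c ω (nhds l) := hl
  -- Write `p x_n p = c_n p` and let `c_n → l` along `ω`. Then `(e - l) p = p e p - l p = 0`, with
  -- `e - l` central.
  let P := BoundedContinuousFunction.const ℕ p
  have key : Ultrapower.mk ω A (P * x * P) = l • Ultrapower.mk ω A P := by
    rw [← map_smul, Ultrapower.mk_eq_mk, mem_cOmega]
    have h1 : Filter.Tendsto (fun n => ‖c n - l‖ * ‖p‖) ω (nhds 0) := by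
      have := ((hl'.sub_const l).norm).mul_const ‖p‖
      simpa using this
    refine h1.congr fun n => ?_
    have : (P * x * P - l • P) n = (c n - l) • p := by
      change p * x n * p - l • p = _
      rw [hc n, sub_smul]
    rw [this, norm_smul]
  refine ⟨l, sub_eq_zero.1 (eq_zero_of_mul_constEmbedding_eq_zero hA ?_ hp0 ?_)⟩
  · rintro _ ⟨a, rfl⟩
    have h1 := he _ ⟨a, rfl⟩
    rw [mul_sub, sub_mul, h1, mul_smul_comm, smul_mul_assoc, mul_one, one_mul]
  · have h1 : Ultrapower.mk ω A P * Ultrapower.mk ω A x = Ultrapower.mk ω A x * Ultrapower.mk ω A P :=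
      he _ ⟨p, rfl⟩
    have h2 : Ultrapower.mk ω A P * Ultrapower.mk ω A P = Ultrapower.mk ω A P := by
      rw [← map_mul]
      congr 1; ext n; exact hpp
    change (Ultrapower.mk ω A x - l • 1) * Ultrapower.mk ω A P = 0
    rw [sub_mul, smul_mul_assoc, one_mul, ← key, map_mul, map_mul, h1, mul_assoc, h2, sub_self]

theorem limit_functional_re_le_of_pointwiseCuntzSubequiv {τ : A →ₗ[ℂ] ℂ}
    (hτ : ∀ x, 0 ≤ τ (star x * x)) (hc : ∀ x y, τ (x * y) = τ (y * x))
    {Ψ : Ultrapower ω A →ₗ[ℂ] ℂ}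
    (hΨ : ∀ x : ℕ →ᵇ A, Filter.Tendsto (fun n => τ (x n)) ω (nhds (Ψ (Ultrapower.mk ω A x))))
    {f : Ultrapower ω A} {z y : A} (hf : PointwiseCuntzSubequiv f z)
    (hz : IsPositiveElement z) (hy : IsSelfAdjoint y) (hyz : y * z = z) :
    (Ψ f).re ≤ ‖f‖ * (τ (y * y)).re := by
  obtain ⟨x, rfl, hx⟩ := hf
  have hy0 : 0 ≤ (τ (y * y)).re := by
    have := (Complex.le_def.1 (hτ y)).1
    rwa [hy.star_eq] at this
  have hlim := (Complex.continuous_re.continuousAt.tendsto).comp (hΨ x)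
  -- A representative may have large entries, but along `ω` their norms are eventually at most the
  -- quotient norm plus `ε`.
  have hε : ∀ ε > 0, (Ψ (Ultrapower.mk ω A x)).re ≤
      (‖Ultrapower.mk ω A x‖ + ε) * (τ (y * y)).re := by
    intro ε hε
    refine le_of_tendsto hlim ?_
    filter_upwards [(Ultrapower.norm_mk_le_iff x (norm_nonneg _)).1 le_rfl ε hε] with n hn
    exact (re_le_of_cuntzSubequiv hτ hc (hx n).2 hz hy hyz).trans
      (mul_le_mul_of_nonneg_right hn hy0)
  have hcont : Filter.Tendsto (fun ε : ℝ => (‖Ultrapower.mk ω A x‖ + ε) * (τ (y * y)).re)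
      (nhdsWithin 0 (Set.Ioi 0)) (nhds ((‖Ultrapower.mk ω A x‖ + 0) * (τ (y * y)).re)) :=
    (Continuous.tendsto (by fun_prop) 0).mono_left nhdsWithin_le_nhds
  rw [add_zero] at hcont
  exact ge_of_tendsto hcont (Filter.eventually_of_mem self_mem_nhdsWithin hε)

/-- If `p ≠ 1`, then `p` and `1 - p` would both have trace at least `1`, against `τ 1 = 1`; and `p =
1` makes `A` one-dimensional. -/
theorem not_isMinimalProjection (hA : IsSimpleCStarAlgebra A) (hdim : Module.rank ℂ A ≠ 1)
    {G : Type v} [Group G] {α : G →* (A ≃⋆ₐ[ℂ] A)} (hα : HasWeakTracialRokhlinProperty ω α)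
    {τ : A →ₗ[ℂ] ℂ} (hτ : τ ∈ tracialStates A) {g : G} (hg : g ≠ 1) (p : A) :
    ¬ IsMinimalProjection p := by
  intro hp
  have : Nontrivial A := hA.1
  obtain ⟨hτ1, hτ0, hτc⟩ := hτ
  obtain ⟨Ψ, hΨ⟩ := exists_limit_functional ω (continuous_of_nonneg hτ0)
  have hΨ1 : Ψ 1 = 1 := by
    rw [← map_one (Ultrapower.mk ω A)]
    refine tendsto_nhds_unique (hΨ 1) (tendsto_const_nhds.congr fun n => ?_)
    exact hτ1.symm
  have key : ∀ q : A, IsSelfAdjoint q → q * q = q → q ≠ 0 → 1 ≤ (τ q).re := by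
    intro q hq hqq hq0
    have hqpos : IsPositiveElement q := by
      have := isPositiveElement_star_mul_self q
      rwa [hq.star_eq, hqq] at this
    obtain ⟨n, T, e, hT, he, horth, hf⟩ := hα {g⁻¹} (1 / 2) (by norm_num) q hqpos hq0
    -- Each `e i` is a scalar, fixed by the action; the levels `h` and `g h` of one tower are
    -- orthogonal, so its square is zero.
    have he0 : ∀ i, e i = 0 := by
      intro i
      obtain ⟨h, hh, hgh⟩ := (hT i).exists_mul_mem (by norm_num)
      obtain ⟨c, hc⟩ := hp.exists_eq_smul_one hA (he i).1
      have h0 := horth i i (g * h) hgh h hh (Or.inl (by simpa using hg))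
      rw [← ultrapowerHom_apply, ← ultrapowerHom_apply, hc, map_smul, map_smul, map_one, map_one,
        smul_mul_smul_comm, mul_one] at h0
      have hc0 : c • (1 : Ultrapower ω A) = 0 := by
        rw [← sub_zero (c • (1 : Ultrapower ω A))]
        have hΨc := congrArg Ψ h0
        rw [map_smul, hΨ1, map_zero, smul_eq_mul, mul_one, mul_self_eq_zero] at hΨc
        rw [hΨc, zero_smul, sub_zero]
      rw [hc, hc0]
    have hsum : (∑ i, ∑ g ∈ T i, ultrapowerMap (α g) (e i)) = 0 := by
      refine Finset.sum_eq_zero fun i _ => Finset.sum_eq_zero fun k _ => ?_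
      rw [he0, ← ultrapowerHom_apply, map_zero]
    rw [hsum, sub_zero] at hf
    -- The remainder is now `1`, and the projection `q` serves as its own local unit.
    have h1 := limit_functional_re_le_of_pointwiseCuntzSubequiv hτ0 hτc hΨ hf hqpos hq hqq
    rw [hΨ1, hqq, Complex.one_re] at h1
    have hn1 : ‖(1 : Ultrapower ω A)‖ ≤ 1 := by
      rw [← map_one (Ultrapower.mk ω A)]
      exact (Ultrapower.norm_mk_le _).trans
        ((BoundedContinuousFunction.norm_le zero_le_one).2 fun n => by simp)
    have hq0' := re_nonneg_of_isPositiveElement hτ0 hqpos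
    nlinarith
  have h1 := key p hp.1 hp.2.1 hp.2.2.1
  have hpe : 1 - p = 0 := by
    by_contra hne
    have h2 := key (1 - p) ((IsSelfAdjoint.one A).sub hp.1) (by
      simp only [mul_sub, sub_mul, mul_one, one_mul, hp.2.1]; abel) hne
    rw [map_sub, hτ1, Complex.sub_re, Complex.one_re] at h2
    linarith
  apply hdim
  rw [sub_eq_zero] at hpe
  refine rank_eq_one (1 : A) one_ne_zero fun b => ?_
  obtain ⟨c, hc⟩ := hp.2.2.2 b
  rw [← hpe, one_mul, mul_one] at hc
  exact ⟨c, hc.symm⟩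

end MinimalProjection

/-! ### Vanishing of traces off `A` -/

section Vanishing

variable {ω : Ultrafilter ℕ} {A : Type u} [CStarAlgebra A] {G : Type v} [Group G]
  {α : G →* (A ≃⋆ₐ[ℂ] A)}

/-- Only covariance enters, so the argument takes place in an arbitrary C⋆-algebra `D` carrying a
covariant pair. -/
theorem apply_mul_unitary_eq_zero (hA : IsSimpleCStarAlgebra A) (hdim : Module.rank ℂ A ≠ 1)
    (hα : HasWeakTracialRokhlinProperty ω α) {D : Type w} [CStarAlgebra D] (π : A →⋆ₐ[ℂ] D)
    (U : G →* unitary D)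
    (hU : ∀ g a, (U g : D) * π a * star (U g : D) = π (α g a))
    {Φ : D →ₗ[ℂ] ℂ} (hΦ : Φ ∈ tracialStates D) {g : G} (hg : g ≠ 1) (a : A) :
    Φ (π a * (U g : D)) = 0 := by
  classical
  have : Nontrivial A := hA.1
  obtain ⟨hΦ1, hΦ0, hΦc⟩ := hΦ
  have hΦcont := continuous_of_nonneg hΦ0
  have hUU : ∀ g, star (U g : D) * (U g : D) = 1 := fun g => (Unitary.mem_iff.1 (U g).2).1
  have hU' : ∀ g b, (U g : D) * π b = π (α g b) * (U g : D) := by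
    intro g b
    rw [← hU, mul_assoc, hUU, mul_one]
  have hπ : ∀ b, ‖π b‖ ≤ ‖b‖ := fun b => NonUnitalStarAlgHom.norm_apply_le π b
  have hπcont : Continuous π := AddMonoidHomClass.continuous_of_bound π 1 fun b => by
    rw [one_mul]; exact hπ b
  let τ : A →ₗ[ℂ] ℂ := Φ ∘ₗ π.toAlgHom.toLinearMap
  have hτ : ∀ b, τ b = Φ (π b) := fun _ => rfl
  have hτ1 : τ 1 = 1 := by rw [hτ, map_one, hΦ1]
  have hτ0 : ∀ x, 0 ≤ τ (star x * x) := fun x => by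
    rw [hτ, map_mul, map_star]; exact hΦ0 _
  have hτc : ∀ x y, τ (x * y) = τ (y * x) := fun x y => by
    rw [hτ, hτ, map_mul π, map_mul π, hΦc]
  have hτα : ∀ h b, τ (α h b) = τ b := fun h b => by
    rw [hτ, hτ, ← hU, hΦc, ← mul_assoc, hUU, one_mul]
  let ψ : A →ₗ[ℂ] ℂ := Φ ∘ₗ LinearMap.mulLeft ℂ (π a * (U g : D)) ∘ₗ π.toAlgHom.toLinearMap
  have hψ : ∀ b, ψ b = Φ (π a * (U g : D) * π b) := fun _ => rfl
  have hψcont : Continuous ψ := by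
    change Continuous fun b => Φ (π a * (U g : D) * π b)
    fun_prop
  obtain ⟨T, hT⟩ := exists_limit_functional ω (continuous_of_nonneg hτ0)
  obtain ⟨F, hF⟩ := exists_limit_functional ω hψcont
  have hT0 : ∀ x, 0 ≤ T (star x * x) := limit_functional_nonneg hτ0 hT
  have hT1 : T 1 = 1 := by
    rw [← map_one (Ultrapower.mk ω A)]
    exact tendsto_nhds_unique (hT 1) (tendsto_const_nhds.congr fun n => hτ1.symm)
  have hF1 : F 1 = Φ (π a * (U g : D)) := by
    rw [← map_one (Ultrapower.mk ω A)]
    refine tendsto_nhds_unique (hF 1) (tendsto_const_nhds.congr fun n => ?_)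
    change _ = ψ 1
    rw [hψ, map_one, mul_one]
  have hTα : ∀ h x, T (ultrapowerHom (α h) x) = T x := by
    intro h x
    obtain ⟨x, rfl⟩ := Ultrapower.mk_surjective x
    rw [ultrapowerHom_apply, ultrapowerMap_mk]
    exact tendsto_nhds_unique (hT _) ((hT x).congr fun n => (hτα h (x n)).symm)
  have hFT : ∀ q, IsPositiveElement q → ‖F q‖ ≤ ‖a‖ * (T q).re := by
    intro q hq
    obtain ⟨s, hs, rfl, -⟩ := hq.exists_sqrt
    obtain ⟨x, rfl⟩ := Ultrapower.mk_surjective s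
    have e : Ultrapower.mk ω A x * Ultrapower.mk ω A x = Ultrapower.mk ω A (star x * x) := by
      rw [map_mul, ← Ultrapower.star_mk, hs.star_eq]
    rw [e]
    have l1 := (hF (star x * x)).norm
    have l2 := ((Complex.continuous_re.continuousAt.tendsto).comp (hT (star x * x))).const_mul ‖a‖
    refine le_of_tendsto_of_tendsto' l1 l2 fun n => ?_
    change ‖ψ (star (x n) * x n)‖ ≤ ‖a‖ * (τ (star (x n) * x n)).re
    rw [hψ, hτ, map_mul π, map_star]
    have h0 := (Complex.le_def.1 (hΦ0 (π (x n)))).1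
    refine (norm_mul_star_mul_self_le hΦ0 hΦc _ _).trans (mul_le_mul_of_nonneg_right ?_ h0)
    calc ‖π a * (U g : D)‖ = ‖π a‖ := CStarRing.norm_mul_coe_unitary _ _
      _ ≤ ‖a‖ := hπ a
  have hForth : ∀ q, IsPositiveElement q → q ∈ centralSequenceAlgebra ω A →
      ultrapowerHom (α g) q * q = 0 → F q = 0 := by
    intro q hq hqc horth
    obtain ⟨s, hs, rfl, hcomm⟩ := hq.exists_sqrt
    have hsa : ∀ b, constEmbedding ω A b * s = s * constEmbedding ω A b := fun b =>
      (hcomm _ (hqc _ ⟨b, rfl⟩).symm).symm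
    have hss : s * ultrapowerHom (α g) s = 0 := by
      rw [map_mul] at horth
      have hs' : IsSelfAdjoint (ultrapowerHom (α g) s) := hs.map _
      have h1 : ultrapowerHom (α g) s * (s * s) = 0 :=
        mul_eq_zero_of_mul_self_mul_eq_zero hs' horth
      have h2 := congrArg star h1
      rw [star_mul, star_mul, hs.star_eq, hs'.star_eq, star_zero] at h2
      exact mul_eq_zero_of_mul_self_mul_eq_zero hs h2
    obtain ⟨x, rfl⟩ := Ultrapower.mk_surjective s
    rw [← map_mul]
    refine tendsto_nhds_unique (hF (x * x)) ?_
    -- By the trace property, `Φ (a U_g x_n²) = Φ (x_n a U_g x_n) = Φ (x_n a α_g(x_n) U_g)`, and the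
    -- class of this `y` is `a s α_g(s) = 0`.
    let y : ℕ →ᵇ A := x * BoundedContinuousFunction.const ℕ a * seqMap (α g) x
    have hy : Ultrapower.mk ω A y = 0 := by
      have : Ultrapower.mk ω A y = Ultrapower.mk ω A x * constEmbedding ω A a *
          ultrapowerHom (α g) (Ultrapower.mk ω A x) := by
        rw [ultrapowerHom_apply, ultrapowerMap_mk]
        simp only [y, map_mul]; rfl
      rw [this, ← hsa, mul_assoc, hss, mul_zero]
    have hy0 : Filter.Tendsto (fun n => y n) ω (nhds 0) := by
      rw [← map_zero (Ultrapower.mk ω A), Ultrapower.mk_eq_mk, sub_zero] at hy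
      exact tendsto_zero_iff_norm_tendsto_zero.2 hy
    have hcont : Continuous fun b => Φ (π b * (U g : D)) := by fun_prop
    have hlim := (hcont.tendsto 0).comp hy0
    simp only [map_zero, zero_mul] at hlim
    refine hlim.congr fun n => ?_
    change Φ (π (x n * a * α g (x n)) * (U g : D)) = ψ (x n * x n)
    rw [hψ, map_mul π, map_mul π, map_mul π, mul_assoc, ← hU', mul_assoc, hΦc]
    simp only [mul_assoc]
  rw [← hF1, ← norm_le_zero_iff]
  have hsmall : ∀ δ > 0, HasSmallElement τ δ :=
    (hasSmallElement_or_exists_isMinimalProjection hτ0 hτ1).resolve_left fun ⟨p, hp⟩ =>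
      not_isMinimalProjection hA hdim hα ⟨hτ1, hτ0, hτc⟩ hg p hp
  have hε : ∀ ε > 0, ‖F 1‖ ≤ 2 * ‖a‖ * ε := by
    intro ε hε
    obtain ⟨z, y, hz, hz0, hy, hyz, hle⟩ := hsmall ε hε
    obtain ⟨n, S, e, hS, he, horth, hf⟩ := hα {g⁻¹} ε hε z hz hz0
    simp only [← ultrapowerHom_apply] at horth hf
    set E := ∑ i, ∑ h ∈ S i, ultrapowerHom (α h) (e i) with hE
    have hepos : ∀ i h, IsPositiveElement (ultrapowerHom (α h) (e i)) := fun i h =>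
      (he i).2.1.map _
    have hEpos : IsPositiveElement E :=
      .sum fun i _ => .sum fun h _ => hepos i h
    have hfpos : IsPositiveElement (1 - E) := by
      obtain ⟨x, hx, hx'⟩ := hf
      rw [← hx]
      exact isPositiveElement_mk fun n => (hx' n).1
    -- This removes the norm factor from the trace estimate for the remainder.
    have hfn : ‖1 - E‖ ≤ 1 := hfpos.norm_le_one hEpos (sub_add_cancel _ _)
    have hTf : (T (1 - E)).re ≤ ε := by
      have h1 := limit_functional_re_le_of_pointwiseCuntzSubequiv hτ0 hτc hT hf hz hy hyz
      have hyy : 0 ≤ (τ (y * y)).re := by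
        have := (Complex.le_def.1 (hτ0 y)).1
        rwa [hy.star_eq] at this
      nlinarith
    have hTE : (T E).re ≤ 1 := by
      have h1 := re_nonneg_of_isPositiveElement hT0 hfpos
      rw [map_sub, hT1, Complex.sub_re, Complex.one_re] at h1
      linarith
    have hFf : ‖F (1 - E)‖ ≤ ‖a‖ * ε :=
      (hFT _ hfpos).trans (mul_le_mul_of_nonneg_left hTf (norm_nonneg _))
    have htower : ∀ i, ‖F (∑ h ∈ S i, ultrapowerHom (α h) (e i))‖ ≤
        ‖a‖ * ε * (T (∑ h ∈ S i, ultrapowerHom (α h) (e i))).re := by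
      intro i
      have hTi := re_nonneg_of_isPositiveElement hT0 (he i).2.1
      -- A level `q = α_h(e_i)` with `g h ∈ S i` is orthogonal to `α_g(q)`, hence is killed by `F`.
      -- The surviving levels all have the same `T`-value.
      have e1 : F (∑ h ∈ S i, ultrapowerHom (α h) (e i)) =
          ∑ h ∈ (S i).filter (fun h => g * h ∉ S i), F (ultrapowerHom (α h) (e i)) := by
        rw [map_sum, Finset.sum_filter_of_ne]
        intro h hh hne hgh
        refine hne (hForth _ (hepos i h)
          (ultrapowerHom_mem_centralSequenceAlgebra _ (he i).1) ?_)
        rw [← ultrapowerHom_mul]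
        exact horth i i _ hgh _ hh (Or.inl (by simpa using hg))
      have e2 : T (∑ h ∈ S i, ultrapowerHom (α h) (e i)) = (S i).card * T (e i) := by
        rw [map_sum, Finset.sum_congr rfl fun h _ => hTα h (e i), Finset.sum_const, nsmul_eq_mul]
      have e3 : (T (∑ h ∈ S i, ultrapowerHom (α h) (e i))).re = (S i).card * (T (e i)).re := by
        rw [e2, ← Complex.ofReal_natCast, Complex.re_ofReal_mul]
      rw [e1, e3]
      calc _ ≤ ∑ h ∈ (S i).filter (fun h => g * h ∉ S i), ‖F (ultrapowerHom (α h) (e i))‖ :=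
            norm_sum_le _ _
        _ ≤ ∑ h ∈ (S i).filter (fun h => g * h ∉ S i), ‖a‖ * (T (e i)).re := by
            refine Finset.sum_le_sum fun h _ => ?_
            have := hFT _ (hepos i h)
            rwa [hTα] at this
        _ = ((S i).filter fun h => g * h ∉ S i).card * (‖a‖ * (T (e i)).re) := by
            rw [Finset.sum_const, nsmul_eq_mul]
        _ ≤ (ε * (S i).card) * (‖a‖ * (T (e i)).re) :=
            mul_le_mul_of_nonneg_right (hS i).card_filter_le (by positivity)
        _ = _ := by ring
    have hFE : ‖F E‖ ≤ ‖a‖ * ε := by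
      calc ‖F E‖ ≤ ∑ i, ‖F (∑ h ∈ S i, ultrapowerHom (α h) (e i))‖ := by
            rw [hE, map_sum]; exact norm_sum_le _ _
        _ ≤ ∑ i, ‖a‖ * ε * (T (∑ h ∈ S i, ultrapowerHom (α h) (e i))).re :=
            Finset.sum_le_sum fun i _ => htower i
        _ = ‖a‖ * ε * (T E).re := by
            rw [← Finset.mul_sum, hE, map_sum, Complex.re_sum]
        _ ≤ ‖a‖ * ε * 1 := by gcongr
        _ = _ := mul_one _
    calc ‖F 1‖ = ‖F (1 - E) + F E‖ := by rw [← map_add, sub_add_cancel]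
      _ ≤ ‖F (1 - E)‖ + ‖F E‖ := norm_add_le _ _
      _ ≤ 2 * ‖a‖ * ε := by linarith
  have hlim : Filter.Tendsto (fun ε : ℝ => 2 * ‖a‖ * ε) (nhdsWithin 0 (Set.Ioi 0))
      (nhds (2 * ‖a‖ * 0)) :=
    (Continuous.tendsto (by fun_prop) 0).mono_left nhdsWithin_le_nhds
  rw [mul_zero] at hlim
  exact ge_of_tendsto hlim (Filter.eventually_of_mem self_mem_nhdsWithin hε)

end Vanishing

/-! ### Density and extensionality in the crossed product -/

namespace CrossedProduct

variable {A : Type u} [CStarAlgebra A] {G : Type v} [Group G] (α : G →* (A ≃⋆ₐ[ℂ] A))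

theorem ofGroup_mul_ofAlgebra (g : G) (a : A) :
    (ofGroup α g : CrossedProduct α) * ofAlgebra α a =
      ofAlgebra α (α g a) * (ofGroup α g : CrossedProduct α) := by
  rw [← covariant, mul_assoc, (Unitary.mem_iff.1 (ofGroup α g).2).1, mul_one]

theorem ofAlgebra_mul_ofGroup_mul (g h : G) (a b : A) :
    ofAlgebra α a * (ofGroup α g : CrossedProduct α) *
        (ofAlgebra α b * (ofGroup α h : CrossedProduct α)) =
      ofAlgebra α (a * α g b) * (ofGroup α (g * h) : CrossedProduct α) := by
  rw [map_mul (ofAlgebra α), map_mul (ofGroup α), Submonoid.coe_mul, mul_assoc, mul_assoc,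
    ← mul_assoc _ (ofAlgebra α b), ofGroup_mul_ofAlgebra]
  simp only [mul_assoc]

theorem star_ofAlgebra_mul_ofGroup (g : G) (a : A) :
    star (ofAlgebra α a * (ofGroup α g : CrossedProduct α)) =
      ofAlgebra α (α g⁻¹ (star a)) * (ofGroup α g⁻¹ : CrossedProduct α) := by
  rw [star_mul, ← map_star, ← ofGroup_mul_ofAlgebra, map_inv]
  rfl

/-- The algebraic crossed product is dense. -/
theorem dense_span : Dense (Submodule.span ℂ (Set.range fun x : A × G =>
    ofAlgebra α x.1 * (ofGroup α x.2 : CrossedProduct α)) : Set (CrossedProduct α)) := by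
  set D := Submodule.span ℂ (Set.range fun x : A × G =>
    ofAlgebra α x.1 * (ofGroup α x.2 : CrossedProduct α)) with hD
  have hbase : ∀ a g, ofAlgebra α a * (ofGroup α g : CrossedProduct α) ∈ D := fun a g =>
    Submodule.subset_span ⟨(a, g), rfl⟩
  have hmul : ∀ x ∈ D, ∀ y ∈ D, x * y ∈ D := by
    intro x hx y hy
    induction hx, hy using Submodule.span_induction₂ with
    | mem_mem x y hx hy =>
      obtain ⟨⟨a, g⟩, rfl⟩ := hx
      obtain ⟨⟨b, h⟩, rfl⟩ := hy
      rw [ofAlgebra_mul_ofGroup_mul]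
      exact hbase _ _
    | zero_left y hy => rw [zero_mul]; exact D.zero_mem
    | zero_right x hx => rw [mul_zero]; exact D.zero_mem
    | add_left x y z _ _ _ h1 h2 => rw [add_mul]; exact D.add_mem h1 h2
    | add_right x y z _ _ _ h1 h2 => rw [mul_add]; exact D.add_mem h1 h2
    | smul_left r x y _ _ h => rw [smul_mul_assoc]; exact D.smul_mem r h
    | smul_right r x y _ _ h => rw [mul_smul_comm]; exact D.smul_mem r h
  have hstar : ∀ x ∈ D, star x ∈ D := by
    intro x hx
    induction hx using Submodule.span_induction with
    | mem x hx =>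
      obtain ⟨⟨a, g⟩, rfl⟩ := hx
      rw [star_ofAlgebra_mul_ofGroup]
      exact hbase _ _
    | zero => rw [star_zero]; exact D.zero_mem
    | add x y _ _ h1 h2 => rw [star_add]; exact D.add_mem h1 h2
    | smul r x _ h => rw [star_smul]; exact D.smul_mem _ h
  -- The span `D` is a ⋆-subalgebra containing the generators, so it exhausts the subalgebra whose
  -- closure is the crossed product.
  have hadj : ∀ y ∈ StarAlgebra.adjoin ℂ
      (Set.range (universalEmbed α) ∪ Set.range (universalUnitary α)),
      ∃ d ∈ D, d.1 = y := by
    intro y hy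
    induction hy using StarAlgebra.adjoin_induction with
    | mem y hy =>
      rcases hy with ⟨a, rfl⟩ | ⟨g, rfl⟩
      · refine ⟨ofAlgebra α a, ?_, rfl⟩
        have := hbase a 1
        rwa [map_one, OneMemClass.coe_one, mul_one] at this
      · refine ⟨ofGroup α g, ?_, rfl⟩
        have := hbase 1 g
        rwa [map_one, one_mul] at this
    | algebraMap r =>
      refine ⟨algebraMap ℂ _ r, ?_, rfl⟩
      have := D.smul_mem r (hbase 1 1)
      rwa [map_one, map_one, OneMemClass.coe_one, mul_one, ← Algebra.algebraMap_eq_smul_one]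
        at this
    | add x y _ _ hx hy =>
      obtain ⟨d, hd, rfl⟩ := hx
      obtain ⟨d', hd', rfl⟩ := hy
      exact ⟨d + d', D.add_mem hd hd', rfl⟩
    | mul x y _ _ hx hy =>
      obtain ⟨d, hd, rfl⟩ := hx
      obtain ⟨d', hd', rfl⟩ := hy
      exact ⟨d * d', hmul d hd d' hd', rfl⟩
    | star x _ hx =>
      obtain ⟨d, hd, rfl⟩ := hx
      exact ⟨star d, hstar d hd, rfl⟩
  intro x
  rw [Metric.mem_closure_iff]
  intro ε hε
  obtain ⟨y, hy, hxy⟩ := Metric.mem_closure_iff.1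
    (show x.1 ∈ closure (StarAlgebra.adjoin ℂ (Set.range (universalEmbed α) ∪
      Set.range (universalUnitary α)) : Set (UniversalTarget α)) from x.2) ε hε
  obtain ⟨d, hd, rfl⟩ := hadj y hy
  exact ⟨d, hd, hxy⟩

variable {α}

theorem linearMap_ext {Φ Ψ : CrossedProduct α →ₗ[ℂ] ℂ} (hΦ : Continuous Φ) (hΨ : Continuous Ψ)
    (h : ∀ a g, Φ (ofAlgebra α a * (ofGroup α g : CrossedProduct α)) =
      Ψ (ofAlgebra α a * (ofGroup α g : CrossedProduct α))) : Φ = Ψ := by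
  refine DFunLike.coe_injective (hΦ.ext_on (dense_span α) hΨ fun x hx => ?_)
  refine LinearMap.eqOn_span (fun y hy => ?_) hx
  obtain ⟨⟨a, g⟩, rfl⟩ := hy
  exact h a g

/-- Density is used in one variable at a time. -/
theorem linearMap_tracial {Φ : CrossedProduct α →ₗ[ℂ] ℂ} (hΦ : Continuous Φ)
    (h : ∀ a g b k, Φ (ofAlgebra α a * (ofGroup α g : CrossedProduct α) *
        (ofAlgebra α b * (ofGroup α k : CrossedProduct α))) =
      Φ (ofAlgebra α b * (ofGroup α k : CrossedProduct α) *
        (ofAlgebra α a * (ofGroup α g : CrossedProduct α))))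
    (x y : CrossedProduct α) : Φ (x * y) = Φ (y * x) := by
  have h1 : ∀ a g, ∀ y, Φ (ofAlgebra α a * (ofGroup α g : CrossedProduct α) * y) =
      Φ (y * (ofAlgebra α a * (ofGroup α g : CrossedProduct α))) := by
    intro a g y
    set u := ofAlgebra α a * (ofGroup α g : CrossedProduct α) with hu
    have := linearMap_ext (Φ := Φ ∘ₗ LinearMap.mulLeft ℂ u) (Ψ := Φ ∘ₗ LinearMap.mulRight ℂ u)
      (hΦ.comp (continuous_const.mul continuous_id)) (hΦ.comp (continuous_id.mul continuous_const))
      (fun b k => h a g b k)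
    exact LinearMap.congr_fun this y
  have := linearMap_ext (Φ := Φ ∘ₗ LinearMap.mulRight ℂ y) (Ψ := Φ ∘ₗ LinearMap.mulLeft ℂ y)
      (hΦ.comp (continuous_id.mul continuous_const)) (hΦ.comp (continuous_const.mul continuous_id))
      (fun a g => h1 a g y)
  exact LinearMap.congr_fun this x

/-- The ⋆-homomorphism from the crossed product to the target of a covariant representation. -/
def eval (R : CovariantRep α) : CrossedProduct α →⋆ₐ[ℂ] R.carrier where
  toFun x := x.1.1 R
  map_one' := rfl
  map_mul' _ _ := rfl
  map_zero' := rfl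
  map_add' _ _ := rfl
  commutes' _ := rfl
  map_star' _ := rfl

end CrossedProduct

open scoped InnerProductSpace

/-! ### The regular representation on `ℓ²(G, H)` -/

section RegularRepresentation

variable {G : Type v} {H : Type u} [NormedAddCommGroup H] [InnerProductSpace ℂ H]

/-- The diagonal operator on `ℓ²(G, H)` with uniformly bounded entries. -/
def diagonalOperator (T : G → H →L[ℂ] H) (C : ℝ) (hT : ∀ g, ‖T g‖ ≤ C) :
    lp (fun _ : G => H) 2 →L[ℂ] lp (fun _ : G => H) 2 :=
  -- Pointwise domination by `C • ξ` gives both square-summability and the norm bound.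
  have hb : ∀ (ξ : lp (fun _ : G => H) 2) g, 
      ‖T g (ξ g)‖ ≤ ‖((C : ℂ) • ξ : lp (fun _ : G => H) 2) g‖ := by
    intro ξ g
    rw [lp.coeFn_smul, Pi.smul_apply, norm_smul, Complex.norm_real]
    exact ((T g).le_of_opNorm_le (hT g) _).trans
      (mul_le_mul_of_nonneg_right (le_abs_self C) (norm_nonneg _))
  LinearMap.mkContinuous
    { toFun := fun ξ => ⟨fun g => T g (ξ g), (lp.memℓp ((C : ℂ) • ξ)).mono' (hb ξ)⟩
      map_add' := fun ξ η => Subtype.ext <| funext fun g => map_add (T g) (ξ g) (η g)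
      map_smul' := fun c ξ => Subtype.ext <| funext fun g => map_smul (T g) c (ξ g) }
    |C| (fun ξ => by
      refine (lp.norm_mono (y := (C : ℂ) • ξ) two_ne_zero (hb ξ)).trans ?_
      rw [norm_smul, Complex.norm_real, Real.norm_eq_abs])

theorem diagonalOperator_apply (T : G → H →L[ℂ] H) (C : ℝ) (hT : ∀ g, ‖T g‖ ≤ C)
    (ξ : lp (fun _ : G => H) 2) (g : G) : diagonalOperator T C hT ξ g = T g (ξ g) := rfl

variable [Group G]

variable (H) in
/-- Left translation on `ℓ²(G, H)`. -/
def translation (h : G) : lp (fun _ : G => H) 2 →L[ℂ] lp (fun _ : G => H) 2 :=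
  LinearMap.mkContinuous
    { toFun := fun ξ => ⟨fun g => ξ (h⁻¹ * g), by
        have h1 := (memℓp_gen_iff (p := 2) (by norm_num)).1 (lp.memℓp ξ)
        exact (memℓp_gen_iff (by norm_num)).2 ((Equiv.mulLeft h⁻¹).summable_iff.2 h1)⟩
      map_add' := fun ξ η => rfl
      map_smul' := fun c ξ => rfl }
    1 (fun ξ => by
      rw [one_mul, lp.norm_eq_tsum_rpow (by norm_num), lp.norm_eq_tsum_rpow (by norm_num)]
      refine le_of_eq (congrArg (· ^ _) ?_)
      exact (Equiv.mulLeft h⁻¹).tsum_eq fun g => ‖ξ g‖ ^ (2 : ℝ≥0∞).toReal)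

theorem translation_apply (h : G) (ξ : lp (fun _ : G => H) 2) (g : G) :
    translation H h ξ g = ξ (h⁻¹ * g) := rfl

variable [CompleteSpace H]

variable (G H) in
/-- Left translation as a unitary representation. -/
def translationHom : G →* unitary (lp (fun _ : G => H) 2 →L[ℂ] lp (fun _ : G => H) 2) where
  toFun h := ⟨translation H h, by
    have hstar : star (translation H h) = translation H h⁻¹ := by
      symm
      rw [ContinuousLinearMap.star_eq_adjoint, ContinuousLinearMap.eq_adjoint_iff]
      intro ξ η
      rw [lp.inner_eq_tsum, lp.inner_eq_tsum, ← (Equiv.mulLeft h⁻¹).tsum_eq]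
      refine tsum_congr fun g => ?_
      simp [translation_apply]
    rw [Unitary.mem_iff, hstar]
    constructor <;>
    · refine ContinuousLinearMap.ext fun ξ => Subtype.ext (funext fun g => ?_)
      change ξ _ = ξ g
      group⟩
  map_one' := by
    refine Subtype.ext (ContinuousLinearMap.ext fun ξ => Subtype.ext (funext fun g => ?_))
    change ξ _ = ξ g
    group
  map_mul' h k := by
    refine Subtype.ext (ContinuousLinearMap.ext fun ξ => Subtype.ext (funext fun g => ?_))
    change ξ _ = ξ _
    group

variable {A : Type u} [CStarAlgebra A] (α : G →* (A ≃⋆ₐ[ℂ] A)) (π : A →⋆ₐ[ℂ] (H →L[ℂ] H))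

theorem norm_map_automorphism_le (a : A) (g : G) : ‖π (α g⁻¹ a)‖ ≤ ‖a‖ :=
  (NonUnitalStarAlgHom.norm_apply_le π _).trans (NonUnitalStarAlgHom.norm_apply_le (α g⁻¹) a)

/-- The representation of `A` on `ℓ²(G, H)` with `(a ξ) g = π (α g⁻¹ a) (ξ g)`. -/
def regularRepHom : A →⋆ₐ[ℂ] (lp (fun _ : G => H) 2 →L[ℂ] lp (fun _ : G => H) 2) where
  toFun a := diagonalOperator (fun g => π (α g⁻¹ a)) ‖a‖ (norm_map_automorphism_le α π a)
  map_one' := by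
    refine ContinuousLinearMap.ext fun ξ => Subtype.ext (funext fun g => ?_)
    change π (α g⁻¹ 1) (ξ g) = ξ g
    rw [map_one, map_one]; rfl
  map_mul' a b := by
    refine ContinuousLinearMap.ext fun ξ => Subtype.ext (funext fun g => ?_)
    change π (α g⁻¹ (a * b)) (ξ g) = π (α g⁻¹ a) (π (α g⁻¹ b) (ξ g))
    rw [map_mul, map_mul]; rfl
  map_zero' := by
    refine ContinuousLinearMap.ext fun ξ => Subtype.ext (funext fun g => ?_)
    change π (α g⁻¹ 0) (ξ g) = 0
    rw [map_zero, map_zero]; rfl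
  map_add' a b := by
    refine ContinuousLinearMap.ext fun ξ => Subtype.ext (funext fun g => ?_)
    change π (α g⁻¹ (a + b)) (ξ g) = π (α g⁻¹ a) (ξ g) + π (α g⁻¹ b) (ξ g)
    rw [map_add, map_add]; rfl
  commutes' c := by
    refine ContinuousLinearMap.ext fun ξ => Subtype.ext (funext fun g => ?_)
    change π (α g⁻¹ (algebraMap ℂ A c)) (ξ g) = c • ξ g
    rw [AlgHomClass.commutes, AlgHomClass.commutes]; rfl
  map_star' a := by
    rw [ContinuousLinearMap.star_eq_adjoint, ContinuousLinearMap.eq_adjoint_iff]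
    intro ξ η
    rw [lp.inner_eq_tsum, lp.inner_eq_tsum]
    refine tsum_congr fun g => ?_
    rw [diagonalOperator_apply, diagonalOperator_apply, map_star, map_star,
      ContinuousLinearMap.star_eq_adjoint, ContinuousLinearMap.adjoint_inner_left]

/-- The regular covariant representation on `ℓ²(G, H)`. -/
def regularRep [Nontrivial H] : CovariantRep α where
  carrier := lp (fun _ : G => H) 2 →L[ℂ] lp (fun _ : G => H) 2
  nontriv := by
    obtain ⟨x, hx⟩ := exists_ne (0 : H)
    classical
    have : Nontrivial (lp (fun _ : G => H) 2) := by
      refine ⟨lp.single 2 1 x, 0, fun h => hx ?_⟩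
      have := congrArg (fun ξ : lp (fun _ : G => H) 2 => ξ 1) h
      simpa using this
    infer_instance
  π := regularRepHom α π
  U := translationHom G H
  covariant g a := by
    have hstar : star (translationHom G H g : lp (fun _ : G => H) 2 →L[ℂ] lp (fun _ : G => H) 2) =
        translationHom G H g⁻¹ := by rw [map_inv]; rfl
    rw [hstar]
    refine ContinuousLinearMap.ext fun ξ => Subtype.ext (funext fun k => ?_)
    change π (α (g⁻¹ * k)⁻¹ a) (ξ (g⁻¹⁻¹ * (g⁻¹ * k))) = π (α k⁻¹ (α g a)) (ξ k)
    have e1 : g⁻¹⁻¹ * (g⁻¹ * k) = k := by group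
    have e2 : (g⁻¹ * k)⁻¹ = k⁻¹ * g := by group
    rw [e1, e2, map_mul]
    rfl

end RegularRepresentation

/-! ### Extending invariant traces -/

section Extension

variable {A : Type u} [CStarAlgebra A] {G : Type v} [Group G] {α : G →* (A ≃⋆ₐ[ℂ] A)}

open CrossedProduct in
/-- The positive functional on the crossed product that is `τ` on `A` and vanishes on
`A λ_g` for `g ≠ 1`. -/
theorem exists_positive_extension {τ : A →ₗ[ℂ] ℂ} (hτ : ∀ x, 0 ≤ τ (star x * x)) (hτ1 : τ 1 = 1) :
    ∃ Φ : CrossedProduct α →ₗ[ℂ] ℂ, (∀ x, 0 ≤ Φ (star x * x)) ∧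
      (∀ a, Φ (ofAlgebra α a) = τ a) ∧
      ∀ a g, g ≠ 1 → Φ (ofAlgebra α a * (ofGroup α g : CrossedProduct α)) = 0 := by
  classical
  let _ := CStarAlgebra.spectralOrder A
  have := CStarAlgebra.spectralOrderedRing A
  let f : A →ₚ[ℂ] ℂ := PositiveLinearMap.mk₀ τ (by
    intro x hx
    obtain ⟨s, hs, rfl, -⟩ := IsPositiveElement.exists_sqrt hx
    simpa [hs.star_eq] using hτ s)
  let ξ₀ : f.GNS := (f.toPreGNS 1 : f.PreGNS)
  have hξ : ∀ a, ⟪ξ₀, f.gnsStarAlgHom a ξ₀⟫_ℂ = τ a := by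
    intro a
    change ⟪ξ₀, f.gnsNonUnitalStarAlgHom a ξ₀⟫_ℂ = τ a
    rw [f.gnsNonUnitalStarAlgHom_apply_coe, UniformSpace.Completion.inner_coe, f.preGNS_inner_def]
    change τ (star 1 * (a * 1)) = τ a
    rw [star_one, one_mul, mul_one]
  have : Nontrivial f.GNS := by
    refine ⟨ξ₀, 0, fun h => ?_⟩
    have := hξ 1
    rw [h, inner_zero_left, hτ1] at this
    exact zero_ne_one this
  let R := regularRep α f.gnsStarAlgHom
  let E := lp (fun _ : G => f.GNS) 2
  let Ω : E := lp.single 2 1 ξ₀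
  let ρ : CrossedProduct α →⋆ₐ[ℂ] (E →L[ℂ] E) := eval R
  let Φ : CrossedProduct α →ₗ[ℂ] ℂ :=
    { toFun := fun x => ⟪Ω, ρ x Ω⟫_ℂ
      map_add' := fun x y => by rw [map_add, add_apply, inner_add_right]
      map_smul' := fun c x => by
        rw [map_smul, smul_apply, inner_smul_right]; rfl }
  -- Pairing with `Ω` reads off the coordinate at `1`, and translation by `g` puts `Ω g⁻¹` there;
  -- this vanishes unless `g = 1`.
  have hΦ : ∀ a g, Φ (ofAlgebra α a * (ofGroup α g : CrossedProduct α)) =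
      ⟪ξ₀, f.gnsStarAlgHom a (Ω g⁻¹)⟫_ℂ := by
    intro a g
    change ⟪Ω, ρ (ofAlgebra α a * (ofGroup α g : CrossedProduct α)) Ω⟫_ℂ = _
    rw [lp.inner_single_left]
    change ⟪ξ₀, f.gnsStarAlgHom (α 1⁻¹ a) (Ω (g⁻¹ * 1))⟫_ℂ = _
    rw [inv_one, map_one, mul_one]
    rfl
  refine ⟨Φ, fun x => ?_, fun a => ?_, fun a g hg => ?_⟩
  · change 0 ≤ ⟪Ω, ρ (star x * x) Ω⟫_ℂ
    rw [map_mul, map_star, ContinuousLinearMap.star_eq_adjoint]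
    change 0 ≤ ⟪Ω, ContinuousLinearMap.adjoint (ρ x) (ρ x Ω)⟫_ℂ
    rw [ContinuousLinearMap.adjoint_inner_right, inner_self_eq_norm_sq_to_K]
    exact pow_nonneg (Complex.zero_le_real.2 (norm_nonneg (ρ x Ω))) 2
  · have h := hΦ a 1
    rw [map_one, OneMemClass.coe_one, mul_one, inv_one] at h
    rw [h, ← hξ]
    congr 2
    exact lp.single_apply_self (E := fun _ : G => f.GNS) 2 1 ξ₀
  · rw [hΦ]
    have : Ω g⁻¹ = 0 := lp.single_apply_ne (E := fun _ : G => f.GNS) 2 1 ξ₀ (by simpa using hg)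
    rw [this, map_zero, inner_zero_right]

open CrossedProduct in
theorem exists_tracial_extension {τ : A →ₗ[ℂ] ℂ} (hτ : τ ∈ invariantTracialStates α) :
    ∃ Φ ∈ tracialStates (CrossedProduct α), restrict α Φ = τ := by
  obtain ⟨⟨hτ1, hτ0, hτc⟩, hτα⟩ := hτ
  obtain ⟨Φ, hΦ0, hΦA, hΦG⟩ := exists_positive_extension (α := α) hτ0 hτ1
  refine ⟨Φ, ⟨?_, hΦ0, ?_⟩, LinearMap.ext hΦA⟩
  · rw [← map_one (ofAlgebra α), hΦA, hτ1]
  refine linearMap_tracial (continuous_of_nonneg hΦ0) fun a g b k => ?_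
  rw [ofAlgebra_mul_ofGroup_mul, ofAlgebra_mul_ofGroup_mul]
  by_cases hgk : g * k = 1
  · have hkg : k * g = 1 := mul_eq_one_comm.1 hgk
    -- For `k = g⁻¹` the two sides are `τ (a α_g(b))` and `τ (b α_k(a))`; invariance under `α_g` and
    -- traciality of `τ` identify them.
    rw [hgk, hkg, map_one, OneMemClass.coe_one, mul_one, mul_one, hΦA, hΦA, hτc, ← hτα g (b * _),
      map_mul (α g)]
    congr 2
    change a = (α g * α k) a
    rw [← map_mul, hgk, map_one]
    rfl
  · have hkg : k * g ≠ 1 := fun h => hgk (mul_eq_one_comm.1 h)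
    rw [hΦG _ _ hgk, hΦG _ _ hkg]

open CrossedProduct in
theorem restrict_mem_invariantTracialStates {Φ : CrossedProduct α →ₗ[ℂ] ℂ}
    (hΦ : Φ ∈ tracialStates (CrossedProduct α)) : restrict α Φ ∈ invariantTracialStates α := by
  obtain ⟨h1, h0, hc⟩ := hΦ
  have e : ∀ a, restrict α Φ a = Φ (ofAlgebra α a) := fun _ => rfl
  refine ⟨⟨?_, fun x => ?_, fun x y => ?_⟩, fun g a => ?_⟩
  · rw [e, map_one, h1]
  · rw [e, map_mul (ofAlgebra α), map_star]; exact h0 _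
  · rw [e, e, map_mul (ofAlgebra α), map_mul (ofAlgebra α), hc]
  · rw [e, e, ← covariant, hc, ← mul_assoc, (Unitary.mem_iff.1 (ofGroup α g).2).1, one_mul]

end Extension
end TracialRokhlin

end

/-! ### The bijection of trace spaces -/

theorem mainTheorem9 {A : Type*} [CStarAlgebra A] (hA : IsSimpleCStarAlgebra A)
    (hdim : Module.rank ℂ A ≠ 1)
    {G : Type*} [Group G] [Countable G] (hG : IsAmenableGroup G)
    (ω : Ultrafilter ℕ) (hω : (ω : Filter ℕ) ≤ Filter.cofinite)
    (α : G →* (A ≃⋆ₐ[ℂ] A)) (hα : HasWeakTracialRokhlinProperty ω α) :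
    Set.BijOn (CrossedProduct.restrict α)
        (tracialStates (CrossedProduct α)) (invariantTracialStates α) ∧
      ∀ Φ ∈ tracialStates (CrossedProduct α), ∀ g : G, g ≠ 1 → ∀ a : A,
        Φ (CrossedProduct.ofAlgebra α a * (CrossedProduct.ofGroup α g : CrossedProduct α)) = 0 := by
  have hzero : ∀ Φ ∈ tracialStates (CrossedProduct α), ∀ g : G, g ≠ 1 → ∀ a : A,
      Φ (CrossedProduct.ofAlgebra α a * (CrossedProduct.ofGroup α g : CrossedProduct α)) = 0 :=
    fun Φ hΦ g hg a => apply_mul_unitary_eq_zero hA hdim hα (CrossedProduct.ofAlgebra α)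
      (CrossedProduct.ofGroup α) (CrossedProduct.covariant α) hΦ hg a
  refine ⟨⟨fun Φ hΦ => restrict_mem_invariantTracialStates hΦ, fun Φ hΦ Ψ hΨ h => ?_,
    fun τ hτ => exists_tracial_extension hτ⟩, hzero⟩
  refine CrossedProduct.linearMap_ext (continuous_of_nonneg hΦ.2.1)
    (continuous_of_nonneg hΨ.2.1) fun a g => ?_
  by_cases hg : g = 1
  · rw [hg, map_one, OneMemClass.coe_one, mul_one]
    exact LinearMap.congr_fun h a
  · rw [hzero Φ hΦ g hg, hzero Ψ hΨ g hg]
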